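/- **Theorem.** Let $\Lambda$ be a ring with $1$ and with an involution $x\mapsto\bar x$, and suppose that $\Lambda$ is weakly finite ($\Lambda^n\cong\Lambda^n\oplus K$ implies $K=0$). Modules are left modules, and $M^*=\mathrm{Hom}_\Lambda(M,\Lambda)$ is a left module by $(af)(x)=f(x)\bar a$; for f.g. free $M$ we identify $M^{**}=M$. Let $q\ge 2$ and $\varepsilon=(-1)^q$. For a sign $\delta=\pm1$ let $Q_\delta(M)=\mathrm{coker}(1-T_\delta)$, where $T_\delta\phi=\delta\phi^*$ on $\mathrm{Hom}(M,M^*)$. *Forms.* A $\delta$-quadratic form $(M,\psi)$ is a f.g. free module $M$ with $\psi\in Q_\delta(M)$; it is non-singular if $\psi+\delta\psi^*:M\to M^*$ is an isomorphism. A lagrangian of it is a direct summand $j:L\hookrightarrow M$ with $j^*\psi j=0\in Q_\delta(L)$ and $L=\{x\in M\mid(\psi+\delta\psi^*)(x)(L)=0\}$. An asymmetric form $(M,\lambda)$ is a f.g. free module $M$ with $\lambda\in\mathrm{Hom}(M,M^*)$; it is non-singular if $\lambda$ is an isomorphism, and a lagrangian of it is a direct summand $L\subset M$ with $L=\{x\in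 M\mid\lambda(x)(L)=0\}$. Forms with a lagrangian are called metabolic. $L_{2q+2}(\Lambda)$ (respectively $LAsy^0(\Lambda)$) is the set of equivalence classes of non-singular $(-\varepsilon)$-quadratic (respectively asymmetric) forms, two forms being equivalent if they become isometric after adding non-singular metabolic forms. *Flip-isomorphisms.* Let $z=(F\xleftarrow{\gamma}G\xrightarrow{\mu}F^*,\bar\theta)$ be a regular $\varepsilon$-quadratic split preformation: $F,G$ are f.g. free and $\bar\theta\in Q_{-\varepsilon}(G)$ satisfies $\theta-\varepsilon\theta^*=\gamma^*\mu$. Let $t=(\alpha,\beta,\bar\nu)$ be a flip-isomorphism of $z$: isomorphisms $\alpha:F\to F^*$, $\beta:G\to G$ and $\bar\nu\in Q_{-\varepsilon}(F^*)$ with $$\alpha\gamma+\alpha(\nu-\varepsilon\nu^*)^*\mu=\varepsilon\mu\beta,\qquad \alpha^{-*}\mu=\gamma\beta,\qquad \bar\theta+\mu^*\bar\nu\mu+\beta^*\bar\theta\beta=0\in Q_{-\varepsilon}(G).$$ *Quadratic complexes.* For a complex $C$ of f.g. free modules let $W_\%(C)_n$ be the group of families $\psi=(\psi_s:C^{n-r-s}\to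 C_r)_{s\ge0,\,r}$, where $C^r=(C_r)^*$, with $(d\psi)_s=d\psi_s+(-1)^r\psi_sd^*+(-1)^{n-s-1}(\psi_{s+1}+(-1)^{s+1}T\psi_{s+1}):C^{n-1-r-s}\to C_r$ and $Tf=(-1)^{ab}f^*$ for $f:C^a\to C_b$. For chain maps $f,f':C\to C'$ and a chain homotopy $\Delta$ with $f'-f=d\Delta+\Delta d$, and $\psi\in W_\%(C)_n$, define $\Delta_\%\psi\in W_\%(C')_{n+1}$ by $$(\Delta_\%\psi)_s=-\Delta\psi_sf^*+(-1)^{r+1}\bigl(f'\psi_s+(-1)^n\Delta T\psi_{s+1}\bigr)\Delta^*:C'^{\,n+1-r-s}\to C'_r .$$ A homotopy $(\Delta,\eta):(f,\chi)\simeq(f',\chi'):(C,\psi)\to(C',\psi')$ consists of such a $\Delta$ and an $\eta\in W_\%(C')_{n+2}$ with $\chi'-\chi=\Delta_\%\psi+d\eta$. *Quadratic signatures.* Choose representatives $\theta:G\to G^*$ of $\bar\theta$ and $\nu:F^*\to F$ of $\bar\nu$ and a $\kappa:G\to G^*$ with $\beta^*\theta\beta+\theta+\mu^*\nu\mu=\kappa+\varepsilon\kappa^*$.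 Let $C$ be the complex $$C_{q+1}=G\xrightarrow{\binom{-\varepsilon\gamma}{-\varepsilon\mu}}C_q=F\oplus F^*\xrightarrow{(\mu^*\ \ \varepsilon\gamma^*)}C_{q-1}=G^*,$$ and let $\psi\in W_\%(C)_{2q}$ have the components $\psi_0=1:C^{q-1}=G\to C_{q+1}=G$, $\psi_0=\begin{pmatrix}0&0\\1&0\end{pmatrix}:C^q=F^*\oplus F\to C_q=F\oplus F^*$, $\psi_1=(\varepsilon\gamma^*\ \ 0):C^q\to C_{q-1}$, $\psi_2=-\varepsilon\theta^*:C^{q-1}\to C_{q-1}$, all others being $0$. Let $h_t:C\to C$ be the chain map with components $\beta$ on $C_{q+1}$, $\begin{pmatrix}0&\alpha^{-*}\\\varepsilon\alpha&\varepsilon\alpha(\nu^*-\varepsilon\nu)\end{pmatrix}$ on $C_q$ and $\beta^{-*}$ on $C_{q-1}$, and let $\chi_t\in W_\%(C)_{2q+1}$ have the components $\chi_1=\begin{pmatrix}0&0\\1&-\alpha\nu^*\alpha^*\end{pmatrix}:C^q\to C_q$, $\chi_2=\binom{0}{\varepsilon\mu-\alpha\nu^*\alpha^*\gamma}:C^{q-1}\to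 C_q$, $\chi_3=-\theta+\beta^{-*}\kappa\beta^{-1}:C^{q-1}\to C_{q-1}$, all others being $0$. Suppose that $$(\Delta,\eta):(1,0)\simeq(h_t,\chi_t):(C,\psi)\to(C,\psi)$$ is a homotopy. Write $\Delta_{q+1}=(R\ \ S):F\oplus F^*\to G$ and let $\eta_0:C^{q+1}=G^*\to C_{q+1}=G$ be the corresponding component of $\eta$. Put $$\xi=\begin{pmatrix}-\eta_0&\beta&0\\0&-\varepsilon\theta^*&0\\R^*&\mu&0\end{pmatrix}:M=G^*\oplus G\oplus F\to M^*,\qquad \rho=\begin{pmatrix}0&0&\alpha\\1&0&-\varepsilon\\0&1&\varepsilon\alpha(\nu^*-\varepsilon\nu)\alpha^*\end{pmatrix}:M'=F\oplus F^*\oplus F\to M'^*.$$ Then $\xi$ represents a non-singular $(-\varepsilon)$-quadratic form and $\rho$ is a non-singular asymmetric form, and the quadratic signature $\rho^*(z,t,\nu,\theta,\kappa,\Delta,\eta)=[(M,\xi)]\in L_{2q+2}(\Lambda)$ is sent by the map $$L_{2q+2}(\Lambda)\to LAsy^0(\Lambda),\qquad(K,\psi)\mapsto(K,\psi-\varepsilon\psi^*)$$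 to the asymmetric signature $\sigma^*(z,t)=[(M',\rho)]\in LAsy^0(\Lambda)$. -/

import Mathlib

/-!
Surgery algebra over a ring with involution: forms, Witt groups, split preformations,
flip-isomorphisms, quadratic chain complexes and their homotopies.

Conventions: `Λ` is a ring with involution `star`, all modules are left modules, and a sign
`ε = ±1` is an element of `ℤˣ`. The sign `(-1) ^ k` of an integer `k` is `Int.negOnePow k`.
-/

open CategoryTheory

universe u

namespace AlgSurgery

/-- `Λ` is weakly finite: `Λⁿ ≅ Λⁿ ⊕ K` implies `K = 0`. -/
def WeaklyFinite (Λ : Type u) [Ring Λ] : Prop :=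
  ∀ (n : ℕ) (K : Type u) [AddCommGroup K] [Module Λ K],
    Nonempty ((Fin n → Λ) ≃ₗ[Λ] (Fin n → Λ) × K) → Subsingleton K

/-! ### Dual modules -/

section Dual

/-- The dual `M* = Hom_Λ(M, Λ)`, a left module by `(a • f) x = f x * star a`. -/
def SDual (Λ M : Type u) [Ring Λ] [AddCommGroup M] [Module Λ M] : Type u := M →ₗ[Λ] Λ

variable {Λ : Type u} [Ring Λ] [StarRing Λ]
variable {M N P : Type u} [AddCommGroup M] [Module Λ M] [AddCommGroup N] [Module Λ N]
  [AddCommGroup P] [Module Λ P]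

instance : AddCommGroup (SDual Λ M) := inferInstanceAs (AddCommGroup (M →ₗ[Λ] Λ))
instance : FunLike (SDual Λ M) M Λ := inferInstanceAs (FunLike (M →ₗ[Λ] Λ) M Λ)
instance : LinearMapClass (SDual Λ M) Λ M Λ :=
  inferInstanceAs (LinearMapClass (M →ₗ[Λ] Λ) Λ M Λ)

@[ext] theorem SDual.ext {f g : SDual Λ M} (h : ∀ x, f x = g x) : f = g := DFunLike.ext _ _ h

@[simp] theorem SDual.add_apply (f g : SDual Λ M) (x : M) : (f + g) x = f x + g x := rfl
@[simp] theorem SDual.zero_apply (x : M) : (0 : SDual Λ M) x = 0 := rfl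
@[simp] theorem SDual.neg_apply (f : SDual Λ M) (x : M) : (-f) x = -f x := rfl
@[simp] theorem SDual.sub_apply (f g : SDual Λ M) (x : M) : (f - g) x = f x - g x := rfl

instance : SMul Λ (SDual Λ M) where
  smul a f :=
    ({ toFun := fun x => f x * star a
       map_add' := fun x y => by rw [map_add, add_mul]
       map_smul' := fun b x => by
        rw [map_smul, smul_eq_mul, RingHom.id_apply, smul_eq_mul, mul_assoc] } : M →ₗ[Λ] Λ)

@[simp] theorem SDual.smul_apply (a : Λ) (f : SDual Λ M) (x : M) : (a • f) x = f x * star a := rfl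

instance : Module Λ (SDual Λ M) where
  one_smul f := by ext x; simp
  mul_smul a b f := by ext x; simp [mul_assoc]
  smul_zero a := by ext x; simp
  smul_add a f g := by ext x; simp [add_mul]
  add_smul a b f := by ext x; simp [mul_add]
  zero_smul f := by ext x; simp

/-- The dual `f* : N* → M*` of `f : M → N`. -/
def dualMap (f : M →ₗ[Λ] N) : SDual Λ N →ₗ[Λ] SDual Λ M where
  toFun φ := LinearMap.comp (show N →ₗ[Λ] Λ from φ) f
  map_add' _ _ := rfl
  map_smul' _ _ := rfl

@[simp] theorem dualMap_apply (f : M →ₗ[Λ] N) (φ : SDual Λ N) (x : M) :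
    dualMap f φ x = φ (f x) := rfl

/-- The canonical map `M → M**`, `x ↦ (f ↦ star (f x))`. -/
def ev (Λ M : Type u) [Ring Λ] [StarRing Λ] [AddCommGroup M] [Module Λ M] :
    M →ₗ[Λ] SDual Λ (SDual Λ M) where
  toFun x :=
    ({ toFun := fun f => star (f x)
       map_add' := fun f g => by simp
       map_smul' := fun a f => by simp } : SDual Λ M →ₗ[Λ] Λ)
  map_add' x y := by
    apply SDual.ext
    intro f
    change star (f (x + y)) = star (f x) + star (f y)
    rw [map_add, star_add]
  map_smul' a x := by
    apply SDual.ext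
    intro f
    change star (f (a • x)) = star (f x) * star a
    rw [map_smul, smul_eq_mul, star_mul]

@[simp] theorem ev_apply (x : M) (f : SDual Λ M) : ev Λ M x f = star (f x) := rfl

/-- Coordinates on the dual of a module with a finite basis. -/
noncomputable def dualCoord {ι : Type u} [Fintype ι] (b : Module.Basis ι Λ M) :
    SDual Λ M ≃ₗ[Λ] (ι → Λ) where
  toFun f i := star (f (b i))
  map_add' f g := by ext i; simp
  map_smul' a f := by ext i; simp
  invFun v := b.constr ℕ (fun i => star (v i))
  left_inv f := by
    change b.constr ℕ (fun i => star (star (f (b i)))) = (show M →ₗ[Λ] Λ from f)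
    apply b.ext
    intro i
    rw [b.constr_basis, star_star]
    rfl
  right_inv v := by
    ext i
    change star (b.constr ℕ (fun i => star (v i)) (b i)) = v i
    rw [b.constr_basis, star_star]

instance [Module.Free Λ M] [Module.Finite Λ M] : Module.Free Λ (SDual Λ M) := by
  classical
  rcases subsingleton_or_nontrivial Λ with h | h
  · exact Module.Free.of_subsingleton' _ _
  · have := Module.Free.ChooseBasisIndex.fintype Λ M
    exact Module.Free.of_equiv (dualCoord (Module.Free.chooseBasis Λ M)).symm

instance [Module.Free Λ M] [Module.Finite Λ M] : Module.Finite Λ (SDual Λ M) := by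
  classical
  have := Module.Free.ChooseBasisIndex.fintype Λ M
  exact Module.Finite.equiv (dualCoord (Module.Free.chooseBasis Λ M)).symm

theorem ev_bijective [Module.Free Λ M] [Module.Finite Λ M] : Function.Bijective (ev Λ M) := by
  classical
  have := Module.Free.ChooseBasisIndex.fintype Λ M
  let b := Module.Free.chooseBasis Λ M
  constructor
  · rw [injective_iff_map_eq_zero]
    intro x hx
    apply b.repr.injective
    ext i
    have h := congrArg (fun φ : SDual Λ (SDual Λ M) => φ (show SDual Λ M from b.coord i)) hx
    change star (b.coord i x) = 0 at h
    rw [star_eq_zero] at h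
    simpa using h
  · intro φ
    refine ⟨∑ i, star (φ (show SDual Λ M from b.coord i)) • b i, ?_⟩
    apply SDual.ext
    intro f
    have hf : f = ∑ i, star (f (b i)) • (show SDual Λ M from b.coord i) := by
      apply (dualCoord b).injective
      rw [map_sum]
      ext j
      rw [Finset.sum_apply, Finset.sum_eq_single j]
      · change star (f (b j)) = star (b.coord j (b j) * star (star (f (b j))))
        simp
      · intro i _ hij
        change star (b.coord i (b j) * star (star (f (b i)))) = 0
        simp [Finsupp.single_eq_of_ne' hij, Finsupp.single_eq_of_ne hij]
      · simp
    conv_rhs => rw [hf, map_sum]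
    rw [ev_apply, map_sum, star_sum]
    refine Finset.sum_congr rfl fun i _ => ?_
    rw [map_smul, map_smul, smul_eq_mul, smul_eq_mul, star_mul, star_star]

/-- The canonical isomorphism `M ≅ M**` of a f.g. free module. -/
noncomputable def evEquiv (Λ M : Type u) [Ring Λ] [StarRing Λ] [AddCommGroup M] [Module Λ M]
    [Module.Free Λ M] [Module.Finite Λ M] : M ≃ₗ[Λ] SDual Λ (SDual Λ M) :=
  LinearEquiv.ofBijective (ev Λ M) ev_bijective

/-- The dual `φ* : N → M*` of `φ : M → N*`, `φ*(x)(y) = star (φ y x)`. -/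
def adj (φ : M →ₗ[Λ] SDual Λ N) : N →ₗ[Λ] SDual Λ M := dualMap φ ∘ₗ ev Λ N

@[simp] theorem adj_apply (φ : M →ₗ[Λ] SDual Λ N) (x : N) (y : M) :
    adj φ x y = star (φ y x) := rfl

/-- The dual `f* : N* → M` of `f : M* → N`, with `M** = M`. -/
noncomputable def coadj [Module.Free Λ M] [Module.Finite Λ M] (f : SDual Λ M →ₗ[Λ] N) :
    SDual Λ N →ₗ[Λ] M := (evEquiv Λ M).symm.toLinearMap ∘ₗ dualMap f

/-- `M* ⊕ N* = (M ⊕ N)*`. -/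
def dualProd (Λ M N : Type u) [Ring Λ] [StarRing Λ] [AddCommGroup M] [Module Λ M]
    [AddCommGroup N] [Module Λ N] : (SDual Λ M × SDual Λ N) ≃ₗ[Λ] SDual Λ (M × N) where
  toFun p := dualMap (LinearMap.fst Λ M N) p.1 + dualMap (LinearMap.snd Λ M N) p.2
  map_add' p q := by ext x; simp; abel
  map_smul' a p := by ext x; simp [add_mul]
  invFun f := (dualMap (LinearMap.inl Λ M N) f, dualMap (LinearMap.inr Λ M N) f)
  left_inv p := by ext x <;> simp
  right_inv f := by
    ext x
    obtain ⟨x, y⟩ := x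
    simp [← map_add]

/-- `(M ⊕ M*)* = M* ⊕ M`. -/
noncomputable def dualHyp (Λ M : Type u) [Ring Λ] [StarRing Λ] [AddCommGroup M] [Module Λ M]
    [Module.Free Λ M] [Module.Finite Λ M] : SDual Λ (M × SDual Λ M) ≃ₗ[Λ] SDual Λ M × M :=
  (dualProd Λ M (SDual Λ M)).symm ≪≫ₗ
    (LinearEquiv.prodCongr (LinearEquiv.refl Λ (SDual Λ M)) (evEquiv Λ M).symm)

/-- The map `A ⊕ B → C ⊕ D` with matrix `(a b; c d)`. -/
def blk {A B C D : Type u} [AddCommGroup A] [Module Λ A] [AddCommGroup B] [Module Λ B]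
    [AddCommGroup C] [Module Λ C] [AddCommGroup D] [Module Λ D]
    (a : A →ₗ[Λ] C) (b : B →ₗ[Λ] C) (c : A →ₗ[Λ] D) (d : B →ₗ[Λ] D) : A × B →ₗ[Λ] C × D :=
  (a.coprod b).prod (c.coprod d)

/-- The form `f* φ f` on `M`, for `f : M → N` and `φ : N → N*`. -/
def pull (f : M →ₗ[Λ] N) : (N →ₗ[Λ] SDual Λ N) →+ (M →ₗ[Λ] SDual Λ M) where
  toFun φ := dualMap f ∘ₗ φ ∘ₗ f
  map_zero' := by ext x y; simp
  map_add' φ ψ := by ext x y; simp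

@[simp] theorem pull_apply (f : M →ₗ[Λ] N) (φ : N →ₗ[Λ] SDual Λ N) (x y : M) :
    pull f φ x y = φ (f x) (f y) := rfl

theorem pull_pull (f : M →ₗ[Λ] N) (g : N →ₗ[Λ] P) (φ : P →ₗ[Λ] SDual Λ P) :
    pull f (pull g φ) = pull (g ∘ₗ f) φ := rfl

/-- The `ε`-duality involution `T_ε φ = ε φ*` on `Hom(M, M*)`. -/
def Tmod (ε : ℤˣ) : (M →ₗ[Λ] SDual Λ M) →+ (M →ₗ[Λ] SDual Λ M) where
  toFun φ := ε • adj φ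
  map_zero' := by
    have : adj (0 : M →ₗ[Λ] SDual Λ M) = 0 := by ext x y; simp
    rw [this, smul_zero]
  map_add' φ ψ := by
    have : adj (φ + ψ) = adj φ + adj ψ := by ext x y; simp
    rw [this, smul_add]

theorem Tmod_Tmod (ε : ℤˣ) (φ : M →ₗ[Λ] SDual Λ M) : Tmod ε (Tmod ε φ) = φ := by
  rcases Int.units_eq_one_or ε with rfl | rfl <;> ext x y <;> simp [Tmod]

theorem pull_Tmod (ε : ℤˣ) (f : M →ₗ[Λ] N) (φ : N →ₗ[Λ] SDual Λ N) :
    pull f (Tmod ε φ) = Tmod ε (pull f φ) := by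
  rcases Int.units_eq_one_or ε with rfl | rfl <;> ext x y <;> simp [Tmod]

/-- The image of `1 - T_ε` on `Hom(M, M*)`. -/
def qRel (Λ : Type u) [Ring Λ] [StarRing Λ] (ε : ℤˣ) (M : Type u) [AddCommGroup M]
    [Module Λ M] : AddSubgroup (M →ₗ[Λ] SDual Λ M) where
  carrier := {χ | ∃ φ : M →ₗ[Λ] SDual Λ M, φ - Tmod ε φ = χ}
  zero_mem' := ⟨0, by rw [map_zero, sub_zero]⟩
  add_mem' := by
    rintro _ _ ⟨φ, rfl⟩ ⟨ψ, rfl⟩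
    exact ⟨φ + ψ, by rw [map_add, add_sub_add_comm]⟩
  neg_mem' := by
    rintro _ ⟨φ, rfl⟩
    exact ⟨-φ, by rw [map_neg, neg_sub, sub_neg_eq_add, neg_add_eq_sub]⟩

/-- `Q_ε(M) = coker (1 - T_ε)`. -/
abbrev QMod (Λ : Type u) [Ring Λ] [StarRing Λ] (ε : ℤˣ) (M : Type u) [AddCommGroup M]
    [Module Λ M] : Type u :=
  (M →ₗ[Λ] SDual Λ M) ⧸ qRel Λ ε M

/-- The class of `φ : M → M*` in `Q_ε(M)`. -/
def QMod.mk (ε : ℤˣ) : (M →ₗ[Λ] SDual Λ M) →+ QMod Λ ε M :=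
  QuotientAddGroup.mk' (qRel Λ ε M)

theorem QMod.mk_surjective (ε : ℤˣ) : Function.Surjective (QMod.mk (Λ := Λ) (M := M) ε) :=
  QuotientAddGroup.mk'_surjective _

/-- The symmetrization `1 + T_ε : Q_ε(M) → Hom(M, M*)`. -/
def QMod.symm (ε : ℤˣ) : QMod Λ ε M →+ (M →ₗ[Λ] SDual Λ M) :=
  QuotientAddGroup.lift (qRel Λ ε M) (AddMonoidHom.id (M →ₗ[Λ] SDual Λ M) + Tmod ε) (by
    rintro _ ⟨φ, rfl⟩
    change φ - Tmod ε φ + Tmod ε (φ - Tmod ε φ) = 0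
    rw [map_sub, Tmod_Tmod]
    abel)

theorem QMod.symm_mk (ε : ℤˣ) (φ : M →ₗ[Λ] SDual Λ M) :
    QMod.symm ε (QMod.mk ε φ) = φ + Tmod ε φ := rfl

/-- The map `Q_ε(N) → Q_ε(M)`, `φ ↦ f* φ f`, induced by `f : M → N`. -/
def QMod.pull (ε : ℤˣ) (f : M →ₗ[Λ] N) : QMod Λ ε N →+ QMod Λ ε M :=
  QuotientAddGroup.map (qRel Λ ε N) (qRel Λ ε M) (AlgSurgery.pull f) (by
    rintro _ ⟨φ, rfl⟩
    exact ⟨AlgSurgery.pull f φ, by rw [map_sub, pull_Tmod]⟩)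

theorem QMod.pull_mk (ε : ℤˣ) (f : M →ₗ[Λ] N) (φ : N →ₗ[Λ] SDual Λ N) :
    QMod.pull ε f (QMod.mk ε φ) = QMod.mk ε (AlgSurgery.pull f φ) := rfl

theorem QMod.pull_pull (ε : ℤˣ) (f : M →ₗ[Λ] N) (g : N →ₗ[Λ] P) (φ : QMod Λ ε P) :
    QMod.pull ε f (QMod.pull ε g φ) = QMod.pull ε (g ∘ₗ f) φ := by
  obtain ⟨φ, rfl⟩ := QMod.mk_surjective ε φ
  rfl

theorem QMod.symm_pull (ε : ℤˣ) (f : M →ₗ[Λ] N) (φ : QMod Λ ε N) :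
    QMod.symm ε (QMod.pull ε f φ) = AlgSurgery.pull f (QMod.symm ε φ) := by
  obtain ⟨φ, rfl⟩ := QMod.mk_surjective ε φ
  rw [QMod.pull_mk, QMod.symm_mk, QMod.symm_mk, map_add, pull_Tmod]

end Dual

/-- A direct summand. -/
def IsDirectSummand {Λ M : Type u} [Ring Λ] [AddCommGroup M] [Module Λ M]
    (L : Submodule Λ M) : Prop := ∃ L' : Submodule Λ M, IsCompl L L'

theorem IsDirectSummand.prod {Λ M N : Type u} [Ring Λ] [AddCommGroup M] [Module Λ M]
    [AddCommGroup N] [Module Λ N] {L : Submodule Λ M} {K : Submodule Λ N}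
    (hL : IsDirectSummand L) (hK : IsDirectSummand K) : IsDirectSummand (L.prod K) := by
  obtain ⟨L', hL'⟩ := hL
  obtain ⟨K', hK'⟩ := hK
  refine ⟨L'.prod K', ?_, ?_⟩
  · rw [disjoint_iff, Submodule.prod_inf_prod, hL'.inf_eq_bot, hK'.inf_eq_bot,
      Submodule.prod_bot]
  · rw [codisjoint_iff, Submodule.prod_sup_prod, hL'.sup_eq_top, hK'.sup_eq_top,
      Submodule.prod_top]

/-! ### Asymmetric forms -/

/-- An asymmetric form: a f.g. free module `M` with a map `M → M*`. -/
structure AsymForm (Λ : Type u) [Ring Λ] [StarRing Λ] : Type (u + 1) where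
  M : Type u
  [grp : AddCommGroup M]
  [mod : Module Λ M]
  [free : Module.Free Λ M]
  [fin : Module.Finite Λ M]
  form : M →ₗ[Λ] SDual Λ M

namespace AsymForm

variable {Λ : Type u} [Ring Λ] [StarRing Λ]

attribute [instance] AsymForm.grp AsymForm.mod AsymForm.free AsymForm.fin

/-- Non-singular: `M → M*` is an isomorphism. -/
def Nonsingular (A : AsymForm Λ) : Prop := Function.Bijective A.form

/-- A lagrangian is a direct summand `L` with `L = {x | φ(x)(L) = 0}`. -/
def IsLagrangian (A : AsymForm Λ) (L : Submodule Λ A.M) : Prop :=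
  IsDirectSummand L ∧ ∀ x : A.M, x ∈ L ↔ ∀ y ∈ L, A.form x y = 0

/-- Non-singular metabolic forms. -/
def Metabolic (A : AsymForm Λ) : Prop := A.Nonsingular ∧ ∃ L, A.IsLagrangian L

/-- The orthogonal sum. -/
def sum (A B : AsymForm Λ) : AsymForm Λ where
  M := A.M × B.M
  form := pull (LinearMap.fst Λ A.M B.M) A.form + pull (LinearMap.snd Λ A.M B.M) B.form

theorem sum_form_apply (A B : AsymForm Λ) (x y : (A.sum B).M) :
    (A.sum B).form x y = A.form x.1 y.1 + B.form x.2 y.2 := rfl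

/-- Existence of an isometry. -/
def Iso (A B : AsymForm Λ) : Prop :=
  ∃ e : A.M ≃ₗ[Λ] B.M, pull e.toLinearMap B.form = A.form

/-- Isometry after adding non-singular metabolic forms. -/
def WittEquiv (A B : AsymForm Λ) : Prop :=
  ∃ X Y : AsymForm Λ, X.Metabolic ∧ Y.Metabolic ∧ (A.sum X).Iso (B.sum Y)

theorem Iso.refl (A : AsymForm Λ) : A.Iso A := ⟨LinearEquiv.refl _ _, rfl⟩

theorem Iso.symm {A B : AsymForm Λ} : A.Iso B → B.Iso A := by
  rintro ⟨e, he⟩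
  refine ⟨e.symm, ?_⟩
  rw [← he, pull_pull]
  ext x y
  simp

theorem Iso.trans {A B C : AsymForm Λ} : A.Iso B → B.Iso C → A.Iso C := by
  rintro ⟨e, he⟩ ⟨f, hf⟩
  refine ⟨e ≪≫ₗ f, ?_⟩
  rw [← he, ← hf, pull_pull]
  rfl

theorem Iso.sum_right {A B : AsymForm Λ} (C : AsymForm Λ) :
    A.Iso B → (A.sum C).Iso (B.sum C) := by
  rintro ⟨e, he⟩
  refine ⟨LinearEquiv.prodCongr e (LinearEquiv.refl Λ C.M), ?_⟩
  ext x y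
  rw [pull_apply, sum_form_apply, sum_form_apply, ← he]
  rfl

theorem Iso.assoc (A B C : AsymForm Λ) : (A.sum (B.sum C)).Iso ((A.sum B).sum C) := by
  refine ⟨(LinearEquiv.prodAssoc Λ A.M B.M C.M).symm, ?_⟩
  ext x y
  rw [pull_apply, sum_form_apply, sum_form_apply, sum_form_apply, sum_form_apply, ← add_assoc]
  rfl

theorem Iso.right_comm (A B C : AsymForm Λ) : ((A.sum B).sum C).Iso ((A.sum C).sum B) := by
  refine ⟨(LinearEquiv.prodAssoc Λ A.M B.M C.M) ≪≫ₗ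
      (LinearEquiv.prodCongr (LinearEquiv.refl Λ A.M) (LinearEquiv.prodComm Λ B.M C.M)) ≪≫ₗ
      (LinearEquiv.prodAssoc Λ A.M C.M B.M).symm, ?_⟩
  ext x y
  rw [pull_apply, sum_form_apply, sum_form_apply, sum_form_apply, sum_form_apply, add_right_comm]
  rfl

theorem Nonsingular.sum {A B : AsymForm Λ} (hA : A.Nonsingular) (hB : B.Nonsingular) :
    (A.sum B).Nonsingular := by
  have h : ((A.sum B).form : (A.sum B).M → SDual Λ (A.sum B).M) =
      (dualProd Λ A.M B.M) ∘ (Prod.map A.form B.form) := by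
    funext x
    rfl
  unfold Nonsingular
  rw [h]
  exact (dualProd Λ A.M B.M).bijective.comp (hA.prodMap hB)

theorem Metabolic.sum {A B : AsymForm Λ} (hA : A.Metabolic) (hB : B.Metabolic) :
    (A.sum B).Metabolic := by
  obtain ⟨hA, L, hL, hL'⟩ := hA
  obtain ⟨hB, K, hK, hK'⟩ := hB
  refine ⟨hA.sum hB, L.prod K, hL.prod hK, ?_⟩
  rintro ⟨x, y⟩
  constructor
  · rintro ⟨hx, hy⟩ ⟨x', y'⟩ ⟨hx', hy'⟩
    refine (sum_form_apply A B _ _).trans ?_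
    simp only
    rw [(hL' x).1 hx x' hx', (hK' y).1 hy y' hy', add_zero]
  · intro h
    refine ⟨(hL' x).2 fun x' hx' => ?_, (hK' y).2 fun y' hy' => ?_⟩
    · have := (sum_form_apply A B _ _).symm.trans (h (x', 0) ⟨hx', K.zero_mem⟩)
      simpa using this
    · have := (sum_form_apply A B _ _).symm.trans (h (0, y') ⟨L.zero_mem, hy'⟩)
      simpa using this

/-- The zero form. -/
def zero (Λ : Type u) [Ring Λ] [StarRing Λ] : AsymForm Λ where
  M := PUnit.{u + 1}
  form := 0

theorem zero_metabolic : (zero Λ).Metabolic := by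
  refine ⟨⟨fun _ _ _ => Subsingleton.elim (α := PUnit.{u + 1}) _ _, fun f => ⟨PUnit.unit, ?_⟩⟩,
    ⊥, ⟨⊤, isCompl_bot_top⟩, fun x => ⟨fun _ y _ => rfl, fun _ => ?_⟩⟩
  · apply SDual.ext
    intro x
    obtain rfl : x = 0 := Subsingleton.elim (α := PUnit.{u + 1}) _ _
    rw [map_zero, map_zero]
  · exact Subsingleton.elim (α := PUnit.{u + 1}) _ _

theorem WittEquiv.trans {A B C : AsymForm Λ} : A.WittEquiv B → B.WittEquiv C → A.WittEquiv C := by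
  rintro ⟨X, Y, hX, hY, h⟩ ⟨X', Y', hX', hY', h'⟩
  refine ⟨X.sum X', Y'.sum Y, hX.sum hX', hY'.sum hY, ?_⟩
  exact (Iso.assoc _ _ _).trans ((h.sum_right X').trans ((Iso.right_comm _ _ _).trans
    ((h'.sum_right Y).trans (Iso.assoc _ _ _).symm)))

/-- Witt equivalence of non-singular asymmetric forms. -/
instance wittSetoid (Λ : Type u) [Ring Λ] [StarRing Λ] :
    Setoid {A : AsymForm Λ // A.Nonsingular} where
  r A B := A.1.WittEquiv B.1
  iseqv :=
    { refl := fun _ => ⟨zero Λ, zero Λ, zero_metabolic, zero_metabolic, Iso.refl _⟩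
      symm := fun ⟨X, Y, hX, hY, h⟩ => ⟨Y, X, hY, hX, h.symm⟩
      trans := WittEquiv.trans }

end AsymForm

/-- The asymmetric Witt group `LAsy⁰(Λ)`, as a set. -/
def LAsy0 (Λ : Type u) [Ring Λ] [StarRing Λ] : Type (u + 1) :=
  Quotient (AsymForm.wittSetoid Λ)

/-- The class of a non-singular asymmetric form in `LAsy⁰(Λ)`. -/
def LAsy0.mk {Λ : Type u} [Ring Λ] [StarRing Λ] (A : AsymForm Λ) (h : A.Nonsingular) : LAsy0 Λ :=
  Quotient.mk (AsymForm.wittSetoid Λ) ⟨A, h⟩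

/-! ### Quadratic forms -/

/-- An `ε`-quadratic form: a f.g. free module `M` with an element of `Q_ε(M)`. -/
structure QuadForm (Λ : Type u) [Ring Λ] [StarRing Λ] (ε : ℤˣ) : Type (u + 1) where
  M : Type u
  [grp : AddCommGroup M]
  [mod : Module Λ M]
  [free : Module.Free Λ M]
  [fin : Module.Finite Λ M]
  form : QMod Λ ε M

namespace QuadForm

variable {Λ : Type u} [Ring Λ] [StarRing Λ] {ε : ℤˣ}

attribute [instance] QuadForm.grp QuadForm.mod QuadForm.free QuadForm.fin

/-- The underlying form `ψ + ε ψ*`, as an asymmetric form. -/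
def toAsym (A : QuadForm Λ ε) : AsymForm Λ where
  M := A.M
  form := QMod.symm ε A.form

/-- Non-singular: `ψ + ε ψ* : M → M*` is an isomorphism. -/
def Nonsingular (A : QuadForm Λ ε) : Prop := Function.Bijective (QMod.symm ε A.form)

/-- A lagrangian is a direct summand `L` on which `ψ` vanishes in `Q_ε(L)` and which equals its
annihilator with respect to `ψ + ε ψ*`. -/
def IsLagrangian (A : QuadForm Λ ε) (L : Submodule Λ A.M) : Prop :=
  IsDirectSummand L ∧ QMod.pull ε L.subtype A.form = 0 ∧
    ∀ x : A.M, x ∈ L ↔ ∀ y ∈ L, QMod.symm ε A.form x y = 0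

/-- Non-singular metabolic forms. -/
def Metabolic (A : QuadForm Λ ε) : Prop := A.Nonsingular ∧ ∃ L, A.IsLagrangian L

/-- The orthogonal sum. -/
def sum (A B : QuadForm Λ ε) : QuadForm Λ ε where
  M := A.M × B.M
  form := QMod.pull ε (LinearMap.fst Λ A.M B.M) A.form +
    QMod.pull ε (LinearMap.snd Λ A.M B.M) B.form

/-- Existence of an isometry. -/
def Iso (A B : QuadForm Λ ε) : Prop :=
  ∃ e : A.M ≃ₗ[Λ] B.M, QMod.pull ε e.toLinearMap B.form = A.form

/-- Isometry after adding non-singular metabolic forms. -/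
def WittEquiv (A B : QuadForm Λ ε) : Prop :=
  ∃ X Y : QuadForm Λ ε, X.Metabolic ∧ Y.Metabolic ∧ (A.sum X).Iso (B.sum Y)

theorem pull_sum (A B : QuadForm Λ ε) {N : Type u} [AddCommGroup N] [Module Λ N]
    (f : N →ₗ[Λ] A.M × B.M) : QMod.pull (N := A.M × B.M) ε f (A.sum B).form =
      QMod.pull ε (LinearMap.fst Λ A.M B.M ∘ₗ f) A.form +
        QMod.pull ε (LinearMap.snd Λ A.M B.M ∘ₗ f) B.form := by
  rw [← QMod.pull_pull, ← QMod.pull_pull, ← map_add]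
  rfl

theorem symm_sum (A B : QuadForm Λ ε) :
    QMod.symm (M := A.M × B.M) ε (A.sum B).form =
      pull (LinearMap.fst Λ A.M B.M) (QMod.symm ε A.form) +
        pull (LinearMap.snd Λ A.M B.M) (QMod.symm ε B.form) := by
  rw [← QMod.symm_pull, ← QMod.symm_pull, ← map_add]
  rfl

theorem toAsym_sum (A B : QuadForm Λ ε) : (A.sum B).toAsym = A.toAsym.sum B.toAsym :=
  congrArg (fun φ : A.M × B.M →ₗ[Λ] SDual Λ (A.M × B.M) => AsymForm.mk (Λ := Λ) _ φ)
    (symm_sum A B)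

theorem Metabolic.toAsym {A : QuadForm Λ ε} (h : A.Metabolic) : A.toAsym.Metabolic := by
  obtain ⟨h, L, hL, -, hL'⟩ := h
  exact ⟨h, L, hL, hL'⟩

theorem Iso.toAsym {A B : QuadForm Λ ε} : A.Iso B → A.toAsym.Iso B.toAsym := by
  rintro ⟨e, he⟩
  refine ⟨e, ?_⟩
  change pull e.toLinearMap (QMod.symm ε B.form) = QMod.symm ε A.form
  rw [← QMod.symm_pull, he]

theorem WittEquiv.toAsym {A B : QuadForm Λ ε} :
    A.WittEquiv B → A.toAsym.WittEquiv B.toAsym := by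
  rintro ⟨X, Y, hX, hY, h⟩
  refine ⟨X.toAsym, Y.toAsym, hX.toAsym, hY.toAsym, ?_⟩
  rw [← toAsym_sum, ← toAsym_sum]
  exact h.toAsym

theorem Iso.refl (A : QuadForm Λ ε) : A.Iso A := by
  refine ⟨LinearEquiv.refl _ _, ?_⟩
  obtain ⟨φ, hφ⟩ := QMod.mk_surjective ε A.form
  rw [← hφ]
  rfl

theorem Iso.symm {A B : QuadForm Λ ε} : A.Iso B → B.Iso A := by
  rintro ⟨e, he⟩
  refine ⟨e.symm, ?_⟩
  rw [← he, QMod.pull_pull]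
  obtain ⟨φ, hφ⟩ := QMod.mk_surjective ε B.form
  rw [← hφ, QMod.pull_mk]
  congr 1
  ext x y
  simp

theorem Iso.trans {A B C : QuadForm Λ ε} : A.Iso B → B.Iso C → A.Iso C := by
  rintro ⟨e, he⟩ ⟨f, hf⟩
  refine ⟨e ≪≫ₗ f, ?_⟩
  rw [← he, ← hf, QMod.pull_pull]
  rfl

theorem Iso.sum_right {A B : QuadForm Λ ε} (C : QuadForm Λ ε) :
    A.Iso B → (A.sum C).Iso (B.sum C) := by
  rintro ⟨e, he⟩
  refine ⟨LinearEquiv.prodCongr e (LinearEquiv.refl Λ C.M), ?_⟩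
  refine (pull_sum B C _).trans ?_
  change _ = QMod.pull ε (LinearMap.fst Λ A.M C.M) A.form +
    QMod.pull ε (LinearMap.snd Λ A.M C.M) C.form
  rw [← he, QMod.pull_pull]
  rfl

theorem Iso.assoc (A B C : QuadForm Λ ε) : (A.sum (B.sum C)).Iso ((A.sum B).sum C) := by
  refine ⟨(LinearEquiv.prodAssoc Λ A.M B.M C.M).symm, ?_⟩
  refine (pull_sum (A.sum B) C _).trans ?_
  refine (congrArg (· + _) (pull_sum A B _)).trans ?_
  refine (add_assoc _ _ _).trans ?_
  exact congrArg (_ + ·) (pull_sum B C (LinearMap.snd Λ A.M (B.M × C.M))).symm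

theorem Iso.right_comm (A B C : QuadForm Λ ε) : ((A.sum B).sum C).Iso ((A.sum C).sum B) := by
  refine ⟨(LinearEquiv.prodAssoc Λ A.M B.M C.M) ≪≫ₗ
      (LinearEquiv.prodCongr (LinearEquiv.refl Λ A.M) (LinearEquiv.prodComm Λ B.M C.M)) ≪≫ₗ
      (LinearEquiv.prodAssoc Λ A.M C.M B.M).symm, ?_⟩
  refine (pull_sum (A.sum C) B _).trans ?_
  refine (congrArg (· + _) (pull_sum A C _)).trans ?_
  refine (add_right_comm _ _ _).trans ?_
  exact congrArg (· + _) (pull_sum A B (LinearMap.fst Λ (A.M × B.M) C.M)).symm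

theorem Nonsingular.sum {A B : QuadForm Λ ε} (hA : A.Nonsingular) (hB : B.Nonsingular) :
    (A.sum B).Nonsingular := by
  have h := AsymForm.Nonsingular.sum (A := A.toAsym) (B := B.toAsym) hA hB
  rw [← toAsym_sum] at h
  exact h

theorem Metabolic.sum {A B : QuadForm Λ ε} (hA : A.Metabolic) (hB : B.Metabolic) :
    (A.sum B).Metabolic := by
  obtain ⟨hA, L, hL, hL₀, hL'⟩ := hA
  obtain ⟨hB, K, hK, hK₀, hK'⟩ := hB
  refine ⟨hA.sum hB, L.prod K, hL.prod hK, ?_, ?_⟩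
  · refine (pull_sum A B (L.prod K).subtype).trans ?_
    let p : L.prod K →ₗ[Λ] L :=
      LinearMap.codRestrict L (LinearMap.fst Λ A.M B.M ∘ₗ (L.prod K).subtype) fun x => x.2.1
    let r : L.prod K →ₗ[Λ] K :=
      LinearMap.codRestrict K (LinearMap.snd Λ A.M B.M ∘ₗ (L.prod K).subtype) fun x => x.2.2
    have hp : LinearMap.fst Λ A.M B.M ∘ₗ (L.prod K).subtype = L.subtype ∘ₗ p := rfl
    have hr : LinearMap.snd Λ A.M B.M ∘ₗ (L.prod K).subtype = K.subtype ∘ₗ r := rfl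
    rw [hp, hr, ← QMod.pull_pull, ← QMod.pull_pull, hL₀, hK₀, map_zero, map_zero, add_zero]
    rfl
  · have key : ∀ x y : A.M × B.M,
        (QMod.symm ε (A.sum B).form : A.M × B.M →ₗ[Λ] SDual Λ (A.M × B.M)) x y =
          QMod.symm ε A.form x.1 y.1 + QMod.symm ε B.form x.2 y.2 := by
      intro x y
      exact congrArg (fun φ : A.M × B.M →ₗ[Λ] SDual Λ (A.M × B.M) => φ x y) (symm_sum A B)
    rintro ⟨x, y⟩
    constructor
    · rintro ⟨hx, hy⟩ ⟨x', y'⟩ ⟨hx', hy'⟩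
      refine (key _ _).trans ?_
      simp only
      rw [(hL' x).1 hx x' hx', (hK' y).1 hy y' hy', add_zero]
    · intro h
      refine ⟨(hL' x).2 fun x' hx' => ?_, (hK' y).2 fun y' hy' => ?_⟩
      · have := (key _ _).symm.trans (h (x', 0) ⟨hx', K.zero_mem⟩)
        simpa using this
      · have := (key _ _).symm.trans (h (0, y') ⟨L.zero_mem, hy'⟩)
        simpa using this

/-- The zero form. -/
def zero (Λ : Type u) [Ring Λ] [StarRing Λ] (ε : ℤˣ) : QuadForm Λ ε where
  M := PUnit.{u + 1}
  form := 0

theorem zero_metabolic : (zero Λ ε).Metabolic := by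
  have h : QMod.symm ε (zero Λ ε).form = (AsymForm.zero Λ).form := map_zero _
  obtain ⟨h₁, L, hL, hL'⟩ := AsymForm.zero_metabolic (Λ := Λ)
  refine ⟨?_, L, hL, map_zero _, ?_⟩
  · unfold Nonsingular
    rw [h]
    exact h₁
  · rw [h]
    exact hL'

theorem WittEquiv.trans {A B C : QuadForm Λ ε} :
    A.WittEquiv B → B.WittEquiv C → A.WittEquiv C := by
  rintro ⟨X, Y, hX, hY, h⟩ ⟨X', Y', hX', hY', h'⟩
  refine ⟨X.sum X', Y'.sum Y, hX.sum hX', hY'.sum hY, ?_⟩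
  exact (Iso.assoc _ _ _).trans ((h.sum_right X').trans ((Iso.right_comm _ _ _).trans
    ((h'.sum_right Y).trans (Iso.assoc _ _ _).symm)))

/-- Witt equivalence of non-singular `ε`-quadratic forms. -/
instance wittSetoid (Λ : Type u) [Ring Λ] [StarRing Λ] (ε : ℤˣ) :
    Setoid {A : QuadForm Λ ε // A.Nonsingular} where
  r A B := A.1.WittEquiv B.1
  iseqv :=
    { refl := fun _ => ⟨zero Λ ε, zero Λ ε, zero_metabolic, zero_metabolic, Iso.refl _⟩
      symm := fun ⟨X, Y, hX, hY, h⟩ => ⟨Y, X, hY, hX, h.symm⟩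
      trans := WittEquiv.trans }

end QuadForm

/-- The Witt group of non-singular `ε`-quadratic forms on f.g. free modules, as a set. For
`ε = (-1) ^ m` it is `L_{2m}(Λ)`. -/
def LQuad (Λ : Type u) [Ring Λ] [StarRing Λ] (ε : ℤˣ) : Type (u + 1) :=
  Quotient (QuadForm.wittSetoid Λ ε)

/-- The class of a non-singular `ε`-quadratic form. -/
def LQuad.mk {Λ : Type u} [Ring Λ] [StarRing Λ] {ε : ℤˣ} (A : QuadForm Λ ε)
    (h : A.Nonsingular) : LQuad Λ ε :=
  Quotient.mk (QuadForm.wittSetoid Λ ε) ⟨A, h⟩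

/-- The canonical map `(K, ψ) ↦ (K, ψ + ε ψ*)` to the asymmetric Witt group. -/
def LQuad.toLAsy0 {Λ : Type u} [Ring Λ] [StarRing Λ] {ε : ℤˣ} : LQuad Λ ε → LAsy0 Λ :=
  Quotient.lift (fun A => LAsy0.mk A.1.toAsym A.2) fun _ _ h =>
    Quotient.sound (s := AsymForm.wittSetoid Λ) (QuadForm.WittEquiv.toAsym h)

/-! ### Split preformations and flip-isomorphisms -/

section Preformation

variable {Λ : Type u} [Ring Λ] [StarRing Λ]
variable {F G : Type u} [AddCommGroup F] [Module Λ F] [Module.Free Λ F] [Module.Finite Λ F]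
  [AddCommGroup G] [Module Λ G] [Module.Free Λ G] [Module.Finite Λ G]

/-- A regular `ε`-quadratic split preformation `(F ← G → F*, θ)` on f.g. free modules:
`(G, γ* μ)` is a `(-ε)`-symmetric form with quadratic refinement `θ ∈ Q_{-ε}(G)`. -/
structure Preformation (Λ : Type u) [Ring Λ] [StarRing Λ] (ε : ℤˣ)
    (F G : Type u) [AddCommGroup F] [Module Λ F] [AddCommGroup G] [Module Λ G] where
  γ : G →ₗ[Λ] F
  μ : G →ₗ[Λ] SDual Λ F
  θ : QMod Λ (-ε) G
  symm_θ : QMod.symm (-ε) θ = dualMap γ ∘ₗ μ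

/-- `α^{-*} : F* → F`, the inverse of the dual `α* : F → F*` of `α : F → F*`. -/
noncomputable def invStar (α : F ≃ₗ[Λ] SDual Λ F) : SDual Λ F →ₗ[Λ] F :=
  coadj (α.symm.toLinearMap)

/-- The class in `Q_ε(F*)` of `ν : F* → F = F**`. -/
def mkDual (ε : ℤˣ) (ν : SDual Λ F →ₗ[Λ] F) : QMod Λ ε (SDual Λ F) :=
  QMod.mk ε (ev Λ F ∘ₗ ν)

/-- `(ν - ε ν*)* : F* → F` for a class `ν ∈ Q_{-ε}(F*)`. -/
noncomputable def symmDual (ε : ℤˣ) (ν : QMod Λ (-ε) (SDual Λ F)) : SDual Λ F →ₗ[Λ] F :=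
  (evEquiv Λ F).symm.toLinearMap ∘ₗ adj (QMod.symm (-ε) ν)

/-- A flip-isomorphism of a regular `ε`-quadratic split preformation. -/
structure FlipIso {ε : ℤˣ} (z : Preformation Λ ε F G) where
  α : F ≃ₗ[Λ] SDual Λ F
  β : G ≃ₗ[Λ] G
  ν : QMod Λ (-ε) (SDual Λ F)
  cond_a : α.toLinearMap ∘ₗ z.γ + α.toLinearMap ∘ₗ symmDual ε ν ∘ₗ z.μ =
    ε • (z.μ ∘ₗ β.toLinearMap)
  cond_b : invStar α ∘ₗ z.μ = z.γ ∘ₗ β.toLinearMap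
  cond_c : z.θ + QMod.pull (-ε) z.μ ν + QMod.pull (-ε) β.toLinearMap z.θ = 0

end Preformation

/-! ### Quadratic structures on chain complexes

A complex `C` of f.g. free modules together with an integer `q` stands for the complex with
`C.X i` in degree `q + i`. Thus `C_{q+i} = C.X i` and `C^{q+i} = (C.X i)*`. -/

section Complexes

variable {Λ : Type u} [Ring Λ] [StarRing Λ]

/-- All modules of the complex are f.g. free. -/
class FGFree (C : ChainComplex (ModuleCat.{u} Λ) ℤ) : Prop where
  free : ∀ i, Module.Free Λ (C.X i)
  fin : ∀ i, Module.Finite Λ (C.X i)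

attribute [instance] FGFree.free FGFree.fin

/-- Families of maps `ψ_s : C^{q+p} → C_{q+r}` for `s ≥ 0` and all `p`, `r`. -/
abbrev Fam (C : ChainComplex (ModuleCat.{u} Λ) ℤ) : Type u :=
  (s : ℕ) → (p r : ℤ) → (SDual Λ (C.X p) →ₗ[Λ] C.X r)

/-- The elements `ψ_s : C^{n-r-s} → C_r` of the chain group `W_%(C)_n`. -/
def IsWChain (q n : ℤ) {C : ChainComplex (ModuleCat.{u} Λ) ℤ} (ψ : Fam C) : Prop :=
  ∀ (s : ℕ) (p r : ℤ), (q + p) + (q + r) + s ≠ n → ψ s p r = 0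

/-- The transposition `T : Hom(C^a, C_b) → Hom(C^b, C_a)`, `f ↦ (-1) ^ (a b) f*`. -/
noncomputable def famT (q : ℤ) {C : ChainComplex (ModuleCat.{u} Λ) ℤ} [FGFree C]
    (ψ : Fam C) : Fam C := fun s p r =>
  Int.negOnePow ((q + p) * (q + r)) • coadj (ψ s r p)

/-- The differential `W_%(C)_n → W_%(C)_{n-1}`,
`(d ψ)_s = d ψ_s + (-1)^r ψ_s d* + (-1)^(n-s-1) (ψ_{s+1} + (-1)^(s+1) T ψ_{s+1})`
as maps `C^{n-1-r-s} → C_r`. -/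
noncomputable def dPct (q n : ℤ) {C : ChainComplex (ModuleCat.{u} Λ) ℤ} [FGFree C]
    (ψ : Fam C) : Fam C := fun s p r =>
  (C.d (r + 1) r).hom ∘ₗ ψ s p (r + 1)
    + Int.negOnePow (q + r) • (ψ s (p + 1) r ∘ₗ dualMap (C.d (p + 1) p).hom)
    + Int.negOnePow (n - s - 1) •
        (ψ (s + 1) p r + Int.negOnePow (s + 1) • famT q ψ (s + 1) p r)

/-- For chain maps `f f' : C → C'` and a chain homotopy `Δ` with `f' - f = d Δ + Δ d`, the map
`Δ_% : W_%(C)_n → W_%(C')_{n+1}`,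
`(Δ_% ψ)_s = - Δ ψ_s f* + (-1)^(r+1) (f' ψ_s + (-1)^n Δ T ψ_{s+1}) Δ*`
as maps `C'^{n+1-r-s} → C'_r`. -/
noncomputable def homotopyPct (q n : ℤ) {C C' : ChainComplex (ModuleCat.{u} Λ) ℤ} [FGFree C]
    {f f' : C ⟶ C'} (Δ : Homotopy f' f) (ψ : Fam C) : Fam C' := fun s p r =>
  -((Δ.hom (r - 1) r).hom ∘ₗ ψ s p (r - 1) ∘ₗ dualMap (f.f p).hom)
    + Int.negOnePow (q + r + 1) •
        (((f'.f r).hom ∘ₗ ψ s (p - 1) r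
          + Int.negOnePow n • ((Δ.hom (r - 1) r).hom ∘ₗ famT q ψ (s + 1) (p - 1) (r - 1)))
        ∘ₗ dualMap (Δ.hom (p - 1) p).hom)

/-- A homotopy `(Δ, η) : (f, χ) ≃ (f', χ')` of morphisms `(C, ψ) → (C', ψ')` of
`n`-dimensional quadratic complexes: a chain homotopy `f' - f = d Δ + Δ d` and an
`η ∈ W_%(C')_{n+2}` with `χ' - χ = Δ_% ψ + d η`. -/
structure QuadHomotopy (q n : ℤ) {C C' : ChainComplex (ModuleCat.{u} Λ) ℤ} [FGFree C] [FGFree C']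
    (ψ : Fam C) (f : C ⟶ C') (χ : Fam C') (f' : C ⟶ C') (χ' : Fam C') where
  Δ : Homotopy f' f
  η : Fam C'
  isWChain_η : IsWChain q (n + 2) η
  eq : χ' - χ = homotopyPct q n Δ ψ + dPct q (n + 2) η

end Complexes

/-! ### The quadratic Poincaré complex of a preformation -/

section Signatures

variable {Λ : Type u} [Ring Λ] [StarRing Λ]
variable {F G : Type u} [AddCommGroup F] [Module Λ F] [Module.Free Λ F] [Module.Finite Λ F]
  [AddCommGroup G] [Module Λ G] [Module.Free Λ G] [Module.Finite Λ G]
variable {ε : ℤˣ}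

/-- The modules `C_{q+1} = G`, `C_q = F ⊕ F*`, `C_{q-1} = G*`. -/
def cpxX (Λ F G : Type u) [Ring Λ] [StarRing Λ] [AddCommGroup F] [Module Λ F] [AddCommGroup G]
    [Module Λ G] : ℤ → ModuleCat.{u} Λ
  | .ofNat 0 => ModuleCat.of Λ (F × SDual Λ F)
  | .ofNat 1 => ModuleCat.of Λ G
  | .negSucc 0 => ModuleCat.of Λ (SDual Λ G)
  | _ => ModuleCat.of Λ PUnit.{u + 1}

/-- The differentials `d_{q+1} = (-ε γ; -ε μ)` and `d_q = (μ* ε γ*)`. -/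
def cpxD (z : Preformation Λ ε F G) : (n : ℤ) → (cpxX Λ F G (n + 1) ⟶ cpxX Λ F G n)
  | .ofNat 0 => ModuleCat.ofHom
      (LinearMap.prod (-(ε • z.γ)) (-(ε • z.μ)) : G →ₗ[Λ] F × SDual Λ F)
  | .negSucc 0 => ModuleCat.ofHom
      (LinearMap.coprod (adj z.μ) (ε • dualMap z.γ) : F × SDual Λ F →ₗ[Λ] SDual Λ G)
  | _ => 0

/-- `γ* μ = - ε μ* γ`. -/
theorem Preformation.symm_eq (z : Preformation Λ ε F G) :
    dualMap z.γ ∘ₗ z.μ = -(ε • (adj z.μ ∘ₗ z.γ)) := by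
  obtain ⟨θ, hθ⟩ := QMod.mk_surjective (-ε) z.θ
  have h := z.symm_θ
  rw [← hθ, QMod.symm_mk] at h
  have h' : Tmod (-ε) (dualMap z.γ ∘ₗ z.μ) = dualMap z.γ ∘ₗ z.μ := by
    rw [← h, map_add, Tmod_Tmod, add_comm]
  rw [← h']
  ext x y
  rcases Int.units_eq_one_or ε with rfl | rfl <;> simp [Tmod]

theorem cpxD_comp (z : Preformation Λ ε F G) (n : ℤ) :
    cpxD z (n + 1) ≫ cpxD z n = 0 := by
  match n with
  | .negSucc 0 =>
    apply ModuleCat.hom_ext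
    change (LinearMap.coprod (adj z.μ) (ε • dualMap z.γ) : F × SDual Λ F →ₗ[Λ] SDual Λ G) ∘ₗ
      (LinearMap.prod (-(ε • z.γ)) (-(ε • z.μ)) : G →ₗ[Λ] F × SDual Λ F) = 0
    have h := z.symm_eq
    ext x y
    have h' := congrArg (fun φ : G →ₗ[Λ] SDual Λ G => φ x y) h
    rcases Int.units_eq_one_or ε with rfl | rfl <;> simp at h' ⊢ <;> simp [h']
  | .ofNat 0 => exact Limits.zero_comp
  | .ofNat (k + 1) => exact Limits.comp_zero
  | .negSucc (k + 1) => exact Limits.comp_zero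

/-- The chain complex `G → F ⊕ F* → G*`. -/
def cpx (z : Preformation Λ ε F G) : ChainComplex (ModuleCat.{u} Λ) ℤ :=
  ChainComplex.of (cpxX Λ F G) (cpxD z) (cpxD_comp z)

instance (z : Preformation Λ ε F G) : FGFree (cpx z) where
  free i := by
    match i with
    | .ofNat 0 => exact inferInstanceAs (Module.Free Λ (F × SDual Λ F))
    | .ofNat 1 => exact inferInstanceAs (Module.Free Λ G)
    | .negSucc 0 => exact inferInstanceAs (Module.Free Λ (SDual Λ G))
    | .ofNat (k + 2) => exact inferInstanceAs (Module.Free Λ PUnit.{u + 1})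
    | .negSucc (k + 1) => exact inferInstanceAs (Module.Free Λ PUnit.{u + 1})
  fin i := by
    match i with
    | .ofNat 0 => exact inferInstanceAs (Module.Finite Λ (F × SDual Λ F))
    | .ofNat 1 => exact inferInstanceAs (Module.Finite Λ G)
    | .negSucc 0 => exact inferInstanceAs (Module.Finite Λ (SDual Λ G))
    | .ofNat (k + 2) => exact inferInstanceAs (Module.Finite Λ PUnit.{u + 1})
    | .negSucc (k + 1) => exact inferInstanceAs (Module.Finite Λ PUnit.{u + 1})

/-- The quadratic structure: `ψ_0 = 1 : C^{q-1} = G → C_{q+1} = G`,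
`ψ_0 = (0 0; 1 0) : C^q = F* ⊕ F → C_q = F ⊕ F*`, `ψ_1 = (ε γ* 0) : C^q → C_{q-1} = G*` and
`ψ_2 = - ε θ* : C^{q-1} = G → C_{q-1} = G*`. -/
noncomputable def cpxPsi (z : Preformation Λ ε F G) (θ : G →ₗ[Λ] SDual Λ G) : Fam (cpx z)
  | 0, .negSucc 0, .ofNat 1 =>
      ((evEquiv Λ G).symm.toLinearMap : SDual Λ (SDual Λ G) →ₗ[Λ] G)
  | 0, .ofNat 0, .ofNat 0 =>
      (blk 0 0 LinearMap.id 0 ∘ₗ (dualHyp Λ F).toLinearMap :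
        SDual Λ (F × SDual Λ F) →ₗ[Λ] F × SDual Λ F)
  | 1, .ofNat 0, .negSucc 0 =>
      (LinearMap.coprod (ε • dualMap z.γ) 0 ∘ₗ (dualHyp Λ F).toLinearMap :
        SDual Λ (F × SDual Λ F) →ₗ[Λ] SDual Λ G)
  | 2, .negSucc 0, .negSucc 0 =>
      (-(ε • (adj θ ∘ₗ (evEquiv Λ G).symm.toLinearMap)) : SDual Λ (SDual Λ G) →ₗ[Λ] SDual Λ G)
  | _, _, _ => 0

/-- The components `h_{q+1} = β`, `h_q = (0 α^{-*}; ε α  ε α (ν* - ε ν))`, `h_{q-1} = β^{-*}`. -/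
noncomputable def flipX {z : Preformation Λ ε F G} (t : FlipIso z) :
    (i : ℤ) → (cpxX Λ F G i ⟶ cpxX Λ F G i)
  | .ofNat 0 => ModuleCat.ofHom
      (blk 0 (invStar t.α) (ε • t.α.toLinearMap)
        (ε • (t.α.toLinearMap ∘ₗ symmDual ε t.ν)) : F × SDual Λ F →ₗ[Λ] F × SDual Λ F)
  | .ofNat 1 => ModuleCat.ofHom t.β.toLinearMap
  | .negSucc 0 => ModuleCat.ofHom (dualMap t.β.symm.toLinearMap : SDual Λ G →ₗ[Λ] SDual Λ G)
  | _ => 0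

theorem apply_invStar (α : F ≃ₗ[Λ] SDual Λ F) (φ g : SDual Λ F) :
    star (g (invStar α φ)) = φ (α.symm g) := by
  have h : ev Λ F (invStar α φ) = dualMap α.symm.toLinearMap φ :=
    (evEquiv Λ F).apply_symm_apply _
  exact congrArg (fun k : SDual Λ (SDual Λ F) => k g) h

theorem apply_symmDual (ν : QMod Λ (-ε) (SDual Λ F)) (φ χ : SDual Λ F) :
    star (χ (symmDual ε ν φ)) = -(ε • φ (symmDual ε ν χ)) := by
  have h : ∀ φ χ : SDual Λ F, star (χ (symmDual ε ν φ)) = star (QMod.symm (-ε) ν χ φ) := by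
    intro φ χ
    have h : ev Λ F (symmDual ε ν φ) = adj (QMod.symm (-ε) ν) φ :=
      (evEquiv Λ F).apply_symm_apply _
    exact congrArg (fun k : SDual Λ (SDual Λ F) => k χ) h
  have h₁ : φ (symmDual ε ν χ) = QMod.symm (-ε) ν φ χ := star_injective (h χ φ)
  rw [h, h₁]
  obtain ⟨ν, rfl⟩ := QMod.mk_surjective (-ε) ν
  rw [QMod.symm_mk]
  rcases Int.units_eq_one_or ε with rfl | rfl <;> simp [Tmod, add_comm]

theorem flipX_comm {z : Preformation Λ ε F G} (t : FlipIso z) (n : ℤ) :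
    flipX t (n + 1) ≫ cpxD z n = cpxD z n ≫ flipX t n := by
  match n with
  | .ofNat 0 =>
    apply ModuleCat.hom_ext
    apply LinearMap.ext
    intro x
    change G at x
    change ((-(ε • z.γ (t.β x)), -(ε • z.μ (t.β x))) : F × SDual Λ F) =
      (0 + invStar t.α (-(ε • z.μ x)), (ε • t.α (-(ε • z.γ x))) +
        ε • t.α (symmDual ε t.ν (-(ε • z.μ x))))
    have ha := LinearMap.congr_fun t.cond_a x
    have hb := LinearMap.congr_fun t.cond_b x
    change t.α (z.γ x) + t.α (symmDual ε t.ν (z.μ x)) = ε • z.μ (t.β x) at ha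
    change invStar t.α (z.μ x) = z.γ (t.β x) at hb
    rw [← hb, ← ha]
    rcases Int.units_eq_one_or ε with rfl | rfl <;> simp [add_comm]
  | .negSucc 0 =>
    apply ModuleCat.hom_ext
    apply LinearMap.ext
    intro w
    change F × SDual Λ F at w
    obtain ⟨f, φ⟩ := w
    change adj z.μ (0 + invStar t.α φ) +
        ε • dualMap z.γ (ε • t.α f + ε • t.α (symmDual ε t.ν φ)) =
      dualMap t.β.symm.toLinearMap (adj z.μ f + ε • dualMap z.γ φ)
    apply SDual.ext
    intro y
    obtain ⟨x, rfl⟩ := t.β.surjective y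
    have ha := LinearMap.congr_fun t.cond_a x
    have hb := LinearMap.congr_fun t.cond_b x
    change t.α (z.γ x) + t.α (symmDual ε t.ν (z.μ x)) = ε • z.μ (t.β x) at ha
    change invStar t.α (z.μ x) = z.γ (t.β x) at hb
    have h₁ : star (z.μ (t.β x) (invStar t.α φ)) =
        ε • (φ (z.γ x) + φ (symmDual ε t.ν (z.μ x))) := by
      rw [apply_invStar]
      have : z.μ (t.β x) = ε • t.α (z.γ x + symmDual ε t.ν (z.μ x)) := by
        rw [map_add, ha, smul_smul, Int.units_mul_self, one_smul]
      rw [this]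
      rcases Int.units_eq_one_or ε with rfl | rfl <;> simp [add_comm]
    have h₂ : ∀ k : F, t.α k (z.γ (t.β x)) = star (z.μ x k) := by
      intro k
      rw [← hb, ← star_star (t.α k _), apply_invStar, LinearEquiv.symm_apply_apply]
    have h₃ := apply_symmDual t.ν φ (z.μ x)
    have h₄ := h₂ (symmDual ε t.ν φ)
    have h₅ := h₂ f
    rw [h₃] at h₄
    change (adj z.μ (0 + invStar t.α φ) +
        ε • dualMap z.γ (ε • t.α f + ε • t.α (symmDual ε t.ν φ))) (t.β x) =
      (adj z.μ f + ε • dualMap z.γ φ) (t.β.symm (t.β x))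
    rw [LinearEquiv.symm_apply_apply, zero_add]
    rcases Int.units_eq_one_or ε with rfl | rfl <;> simp at h₁ h₄ h₅ ⊢ <;>
      rw [h₁, h₄, h₅] <;> abel
  | .ofNat (k + 1) => exact Limits.comp_zero.trans Limits.zero_comp.symm
  | .negSucc (k + 1) => exact Limits.comp_zero.trans Limits.zero_comp.symm

/-- The chain map `h_t`. -/
noncomputable def flipMap {z : Preformation Λ ε F G} (t : FlipIso z) : cpx z ⟶ cpx z where
  f := flipX t
  comm' i j h := by
    obtain rfl : j + 1 = i := h
    have h₁ : (cpx z).d (j + 1) j = cpxD z j :=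
      ChainComplex.of_d (cpxX Λ F G) (cpxD z) j
    rw [h₁]
    exact flipX_comm t j

/-- The quadratic structure `χ_t` of `h_t`: `χ_1 = (0 0; 1 -α ν* α*) : C^q → C_q`,
`χ_2 = (0; ε μ - α ν* α* γ) : C^{q-1} → C_q` and
`χ_3 = - θ + β^{-*} κ β^{-1} : C^{q-1} → C_{q-1}`. -/
noncomputable def flipChi {z : Preformation Λ ε F G} (t : FlipIso z) (θ : G →ₗ[Λ] SDual Λ G)
    (ν : SDual Λ F →ₗ[Λ] F) (κ : G →ₗ[Λ] SDual Λ G) : Fam (cpx z)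
  | 1, .ofNat 0, .ofNat 0 =>
      (blk 0 0 LinearMap.id (-(t.α.toLinearMap ∘ₗ coadj ν ∘ₗ adj t.α.toLinearMap)) ∘ₗ
        (dualHyp Λ F).toLinearMap : SDual Λ (F × SDual Λ F) →ₗ[Λ] F × SDual Λ F)
  | 2, .negSucc 0, .ofNat 0 =>
      (LinearMap.prod 0
        (ε • z.μ - t.α.toLinearMap ∘ₗ coadj ν ∘ₗ adj t.α.toLinearMap ∘ₗ z.γ) ∘ₗ
        (evEquiv Λ G).symm.toLinearMap : SDual Λ (SDual Λ G) →ₗ[Λ] F × SDual Λ F)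
  | 3, .negSucc 0, .negSucc 0 =>
      ((-θ + pull t.β.symm.toLinearMap κ) ∘ₗ (evEquiv Λ G).symm.toLinearMap :
        SDual Λ (SDual Λ G) →ₗ[Λ] SDual Λ G)
  | _, _, _ => 0

/-! ### Quadratic and asymmetric signatures -/

/-- The data of a quadratic signature: representatives `θ`, `ν` of the quadratic refinements, a
`κ` with `β* θ β + θ + μ* ν μ = κ + ε κ*`, and a homotopy
`(Δ, η) : (1, 0) ≃ (h_t, χ_t) : (C, ψ) → (C, ψ)`. -/
structure SignatureData (q : ℤ) {z : Preformation Λ ε F G} (t : FlipIso z) where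
  θ : G →ₗ[Λ] SDual Λ G
  mk_θ : QMod.mk (-ε) θ = z.θ
  ν : SDual Λ F →ₗ[Λ] F
  mk_ν : mkDual (-ε) ν = t.ν
  κ : G →ₗ[Λ] SDual Λ G
  eq_κ : pull t.β.toLinearMap θ + θ + adj z.μ ∘ₗ ν ∘ₗ z.μ = κ + ε • adj κ
  homotopy : QuadHomotopy q (2 * q) (cpxPsi z θ) (𝟙 (cpx z)) 0 (flipMap t) (flipChi t θ ν κ)

/-- The form on `A ⊕ B ⊕ C` with rows `a`, `b`, `c`. -/
def formOfRows {A B C : Type u} [AddCommGroup A] [Module Λ A] [AddCommGroup B] [Module Λ B]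
    [AddCommGroup C] [Module Λ C] (a : A × B × C →ₗ[Λ] SDual Λ A)
    (b : A × B × C →ₗ[Λ] SDual Λ B) (c : A × B × C →ₗ[Λ] SDual Λ C) :
    A × B × C →ₗ[Λ] SDual Λ (A × B × C) :=
  (dualProd Λ A (B × C)).toLinearMap ∘ₗ
    LinearMap.prod a ((dualProd Λ B C).toLinearMap ∘ₗ LinearMap.prod b c)

/-- The map `A ⊕ B ⊕ C → D` with entries `a`, `b`, `c`. -/
def row {A B C D : Type u} [AddCommGroup A] [Module Λ A] [AddCommGroup B] [Module Λ B]
    [AddCommGroup C] [Module Λ C] [AddCommGroup D] [Module Λ D]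
    (a : A →ₗ[Λ] D) (b : B →ₗ[Λ] D) (c : C →ₗ[Λ] D) : A × B × C →ₗ[Λ] D :=
  a.coprod (b.coprod c)

/-- The form `ξ = (-η_0 β 0; 0 -ε θ* 0; R* μ 0)` on `M = G* ⊕ G ⊕ F`, where
`Δ_{q+1} = (R S) : F ⊕ F* → G` and `η_0 : C^{q+1} = G* → C_{q+1} = G`. -/
noncomputable def SignatureData.quadForm {q : ℤ} {z : Preformation Λ ε F G} {t : FlipIso z}
    (D : SignatureData q t) : QuadForm Λ (-ε) :=
  let R : F →ₗ[Λ] G :=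
    ((D.homotopy.Δ.hom 0 1).hom : F × SDual Λ F →ₗ[Λ] G) ∘ₗ LinearMap.inl Λ F (SDual Λ F)
  let η₀ : SDual Λ G →ₗ[Λ] G := D.homotopy.η 0 1 1
  { M := SDual Λ G × G × F
    form := QMod.mk (-ε) (formOfRows
      (row (-(ev Λ G ∘ₗ η₀)) (ev Λ G ∘ₗ t.β.toLinearMap) 0)
      (row 0 (-(ε • adj D.θ)) 0)
      (row (dualMap R) z.μ 0)) }

/-- The form `ρ = (0 0 α; 1 0 -ε; 0 1 ε α (ν* - ε ν) α*)` on `F ⊕ F* ⊕ F` which represents the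
asymmetric signature. -/
noncomputable def FlipIso.asymForm {z : Preformation Λ ε F G} (t : FlipIso z) : AsymForm Λ where
  M := F × SDual Λ F × F
  form := formOfRows
    (row 0 0 t.α.toLinearMap)
    (row (ev Λ F) 0 (-(ε • ev Λ F)))
    (row 0 LinearMap.id
      (ε • (t.α.toLinearMap ∘ₗ symmDual ε t.ν ∘ₗ adj t.α.toLinearMap)))

end Signatures

end AlgSurgery

/-! Let `Φ` be the `ε`-symmetric hyperbolic form on `F ⊕ F*`. The degree `q` part `h` of the flip
chain map is an isometry of `Φ` with `h(F) = F*`. The homotopy `(Δ, η)` provides a non-singular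
asymmetric form `A` on `E = G* ⊕ G` that "fills" `h`. There is a map `w : E → F ⊕ F*`, built from
the dual of `Δ_{q+1}` and from `(γ; μ)`, with `A + ε A* = w* Φ w`. The monodromy `T = -ε A^{-*} A`
then covers `h`, that is `w T = h w`. There is also a variation map `ζ : F ⊕ F* → E` with `w ζ = 1 -
h⁻¹` and `A(ζ v, e) = Φ(v, w e)`. Finally `0 ⊕ G` is a lagrangian of `A` stable under `T`. The
structure `TwistedDouble` records exactly this, and the rest of the argument is linear algebra with
it.

Such a datum determines two forms: `fstForm` on `E ⊕ F`, which involves `A`, and `sndForm` on `(F ⊕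
F*) ⊕ F*`, which involves only `h`. Explicit shears identify `fstForm` with the symmetrization `ξ -
ε ξ*` (`quadForm_iso`) and `sndForm` with `ρ` (`asymForm_iso`), so it suffices that the two are Witt
equivalent. For this a third form `thdForm` on `E ⊕ E ⊕ E` is added. It is metabolic because `A` has
a `T`-stable lagrangian (`thdForm_metabolic`), and `fstForm ⊕ -sndForm ⊕ thdForm` has an explicit
lagrangian parametrised by `F ⊕ F ⊕ E ⊕ E` (`total_metabolic`). Cancellation
(`wittEquiv_of_metabolic`) concludes.

The chain-level input is small. The chain homotopy in degrees `q+1` and `q` gives `Δ₁_incl` and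
`hypEquiv_eq`. The two components `C^{q+1} → C_q` and `C^q → C_{q+1}` of the equation for `η` at `s
= 0` combine to `H_proj_add`, from which `η_1` has been eliminated. -/

namespace AlgSurgery

/-! ### Witt equivalence of asymmetric forms -/

namespace AsymForm

variable {Λ : Type u} [Ring Λ] [StarRing Λ]

/-- The form `-φ`. -/
def neg (A : AsymForm Λ) : AsymForm Λ where
  M := A.M
  form := -A.form

theorem Nonsingular.neg {A : AsymForm Λ} (h : A.Nonsingular) : A.neg.Nonsingular :=
  (LinearEquiv.neg Λ (M := SDual Λ A.M)).bijective.comp h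

theorem Nonsingular.of_iso {A B : AsymForm Λ} (h : A.Iso B) (hB : B.Nonsingular) :
    A.Nonsingular := by
  obtain ⟨e, he⟩ := h
  have hd : Function.Bijective (dualMap (Λ := Λ) e.toLinearMap) := by
    constructor
    · intro f g hfg
      ext x
      have := congrArg (fun k : SDual Λ A.M => k (e.symm x)) hfg
      simpa using this
    · intro f
      refine ⟨dualMap e.symm.toLinearMap f, ?_⟩
      ext x
      simp
  have : (A.form : A.M → SDual Λ A.M) =
      dualMap (Λ := Λ) e.toLinearMap ∘ B.form ∘ e := by
    rw [← he]
    rfl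
  unfold Nonsingular
  rw [this]
  exact hd.comp (Function.Bijective.comp hB e.bijective)

theorem Iso.wittEquiv {A B : AsymForm Λ} (h : A.Iso B) : A.WittEquiv B :=
  ⟨zero Λ, zero Λ, zero_metabolic, zero_metabolic, h.sum_right _⟩

/-- A criterion for the image of an isotropic map `j` to be a lagrangian. -/
theorem isLagrangian_range {A : AsymForm Λ} {L Q : Type u} [AddCommGroup L] [Module Λ L]
    [AddCommGroup Q] [Module Λ Q] (j : L →ₗ[Λ] A.M) (k : Q →ₗ[Λ] A.M)
    (hj : ∀ x y, A.form (j x) (j y) = 0) (hjk : ∀ m, ∃ x y, j x + k y = m)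
    (hk : ∀ y, (∀ x, A.form (k y) (j x) = 0) → y = 0) : A.IsLagrangian (LinearMap.range j) := by
  refine ⟨⟨LinearMap.range k, ?_, ?_⟩, ?_⟩
  · rw [Submodule.disjoint_def]
    rintro _ ⟨x, rfl⟩ ⟨y, hy⟩
    -- A common element `k y = j x` of the two images is orthogonal to the image of the isotropic
    -- map `j`, so `hk` forces `y = 0`.
    rw [← hy, hk y fun x' => by rw [hy, hj], map_zero]
  · rw [codisjoint_iff, eq_top_iff]
    intro m _
    obtain ⟨x, y, rfl⟩ := hjk m
    exact Submodule.add_mem_sup ⟨x, rfl⟩ ⟨y, rfl⟩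
  · intro m
    constructor
    · rintro ⟨x, rfl⟩ _ ⟨y, rfl⟩
      exact hj x y
    · intro h
      obtain ⟨x, y, rfl⟩ := hjk m
      have : y = 0 := hk y fun x' => by
        have := h (j x') ⟨x', rfl⟩
        rwa [map_add, SDual.add_apply, hj, zero_add] at this
      rw [this, map_zero, add_zero]
      exact ⟨x, rfl⟩

/-- The diagonal is a lagrangian, with the second summand as complement. -/
theorem metabolic_neg_sum_self {A : AsymForm Λ} (hA : A.Nonsingular) :
    (A.neg.sum A).Metabolic := by
  refine ⟨hA.neg.sum hA, _, isLagrangian_range (A := A.neg.sum A)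
    (LinearMap.prod LinearMap.id LinearMap.id : A.M →ₗ[Λ] A.M × A.M)
    (LinearMap.inr Λ A.M A.M) ?_ ?_ ?_⟩
  · intro x y
    change -A.form x y + A.form x y = 0
    exact neg_add_cancel _
  · rintro ⟨(x : A.M), (y : A.M)⟩
    refine ⟨x, (y - x : A.M), ?_⟩
    change ((x + 0, x + (y - x)) : A.M × A.M) = (x, y)
    simp
  · intro y h
    apply hA.1
    ext x
    have := h x
    change -A.form 0 x + A.form y x = 0 at this
    simpa using this

/-- Permuting summands identifies `A ⊕ (-B ⊕ B ⊕ C)` with `B ⊕ (A ⊕ -B ⊕ C)`, and both brackets are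
metabolic. -/
theorem wittEquiv_of_metabolic {A B C : AsymForm Λ} (hB : B.Nonsingular) (hC : C.Metabolic)
    (h : ((A.sum B.neg).sum C).Metabolic) : A.WittEquiv B := by
  refine ⟨(B.neg.sum B).sum C, (A.sum B.neg).sum C, (metabolic_neg_sum_self hB).sum hC, h, ?_⟩
  refine ⟨{ toFun := fun x => (x.2.1.2, ((x.1, x.2.1.1), x.2.2))
            invFun := fun x => (x.2.1.1, ((x.2.1.2, x.1), x.2.2))
            map_add' := fun _ _ => rfl
            map_smul' := fun _ _ => rfl
            left_inv := fun _ => rfl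
            right_inv := fun _ => rfl }, ?_⟩
  ext x y
  change B.form x.2.1.2 y.2.1.2 +
      ((A.form x.1 y.1 + -B.form x.2.1.1 y.2.1.1) + C.form x.2.2 y.2.2) =
    A.form x.1 y.1 + ((-B.form x.2.1.1 y.2.1.1 + B.form x.2.1.2 y.2.1.2) + C.form x.2.2 y.2.2)
  abel

end AsymForm

/-! ### Twisted doubles -/

section TwistedDouble

variable {Λ : Type u} [Ring Λ] [StarRing Λ]

/-- The `ε`-symmetric hyperbolic form on `F ⊕ F*`. -/
def hyp (ε : ℤˣ) (F : Type u) [AddCommGroup F] [Module Λ F] :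
    F × SDual Λ F →ₗ[Λ] SDual Λ (F × SDual Λ F) :=
  dualMap (LinearMap.fst Λ F (SDual Λ F)) ∘ₗ LinearMap.snd Λ F (SDual Λ F) +
    ε • (dualMap (LinearMap.snd Λ F (SDual Λ F)) ∘ₗ ev Λ F ∘ₗ LinearMap.fst Λ F (SDual Λ F))

theorem SDual.apply_prod {M N : Type u} [AddCommGroup M] [Module Λ M] [AddCommGroup N] [Module Λ N]
    (φ : SDual Λ (M × N)) (x : M) (y : N) : φ (x, 0) + φ (0, y) = φ (x, y) := by
  rw [← map_add, Prod.mk_add_mk, add_zero, zero_add]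

variable {F : Type u} [AddCommGroup F] [Module Λ F]

theorem hyp_apply (ε : ℤˣ) (v v' : F × SDual Λ F) :
    hyp ε F v v' = v.2 v'.1 + ε • star (v'.2 v.1) := by
  rcases Int.units_eq_one_or ε with rfl | rfl <;> simp [hyp]

theorem hyp_symm (ε : ℤˣ) (v v' : F × SDual Λ F) :
    hyp ε F v v' = ε • star (hyp ε F v' v) := by
  rw [hyp_apply, hyp_apply]
  rcases Int.units_eq_one_or ε with rfl | rfl <;> simp [add_comm]

theorem hyp_inl (ε : ℤˣ) (v : F × SDual Λ F) (x : F) :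
    hyp ε F v (LinearMap.inl Λ F (SDual Λ F) x) = v.2 x := by
  rw [hyp_apply]
  rcases Int.units_eq_one_or ε with rfl | rfl <;> simp

theorem hyp_inl_left (ε : ℤˣ) (x : F) (v : F × SDual Λ F) :
    hyp ε F (LinearMap.inl Λ F (SDual Λ F) x) v = ε • star (v.2 x) := by
  rw [hyp_apply]
  rcases Int.units_eq_one_or ε with rfl | rfl <;> simp

theorem hyp_inr_left (ε : ℤˣ) (y : SDual Λ F) (v : F × SDual Λ F) :
    hyp ε F (LinearMap.inr Λ F (SDual Λ F) y) v = y v.1 := by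
  rw [hyp_apply]
  rcases Int.units_eq_one_or ε with rfl | rfl <;> simp

theorem hyp_inl_inl (ε : ℤˣ) (x x' : F) :
    hyp ε F (LinearMap.inl Λ F (SDual Λ F) x) (LinearMap.inl Λ F (SDual Λ F) x') = 0 := by
  rw [hyp_inl]
  rfl

theorem hyp_inr_inr (ε : ℤˣ) (y y' : SDual Λ F) :
    hyp ε F (LinearMap.inr Λ F (SDual Λ F) y) (LinearMap.inr Λ F (SDual Λ F) y') = 0 := by
  rw [hyp_inr_left]
  exact map_zero y

/-- Both `F` and `F*` are isotropic, so only the mixed terms survive. Writing them through the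
`F`-components suits `h`, which is explicit on `F`. -/
theorem hyp_eq_add (ε : ℤˣ) (v v' : F × SDual Λ F) :
    hyp ε F v v' = hyp ε F (LinearMap.inl Λ F (SDual Λ F) v.1) v' +
      hyp ε F v (LinearMap.inl Λ F (SDual Λ F) v'.1) := by
  rw [hyp_inl, hyp_inl_left, hyp_apply, add_comm]

theorem hyp_injective (ε : ℤˣ) [Module.Free Λ F] [Module.Finite Λ F] {v v' : F × SDual Λ F}
    (h : ∀ x, hyp ε F x v = hyp ε F x v') : v = v' := by
  have h₂ : v.2 = v'.2 := by
    ext x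
    have := h (LinearMap.inl Λ F (SDual Λ F) x)
    rw [hyp_inl_left, hyp_inl_left] at this
    exact star_injective (smul_left_cancel ε this)
  have h₁ : v.1 = v'.1 := by
    apply (ev_bijective (Λ := Λ)).1
    ext y
    have := h (LinearMap.inr Λ F (SDual Λ F) y)
    rw [hyp_inr_left, hyp_inr_left] at this
    rw [ev_apply, ev_apply, this]
  exact Prod.ext h₁ h₂

/-- The bilinear pairing `(x, y) ↦ φ (f x) (g y)`. -/
def bil {M N P : Type u} [AddCommGroup M] [Module Λ M] [AddCommGroup N] [Module Λ N]
    [AddCommGroup P] [Module Λ P] (φ : N →ₗ[Λ] SDual Λ P) (f : M →ₗ[Λ] N) (g : M →ₗ[Λ] P) :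
    M →ₗ[Λ] SDual Λ M := dualMap g ∘ₗ φ ∘ₗ f

/-- A non-singular form `A` on `E` with monodromy `T`, a map `w : E → F ⊕ F*` which carries
`A (1 - T)` to the hyperbolic form `Φ` and `T` to an isometry `h` of `Φ` such that `F` and `h F`
are complementary, and a variation map `ζ` of `h`; the form `A` has a lagrangian `K`. -/
structure TwistedDouble (Λ : Type u) [Ring Λ] [StarRing Λ] (ε : ℤˣ) (E F : Type u)
    [AddCommGroup E] [Module Λ E] [AddCommGroup F] [Module Λ F] where
  h : (F × SDual Λ F) ≃ₗ[Λ] F × SDual Λ F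
  hyp_h : ∀ v v', hyp ε F (h v) (h v') = hyp ε F v v'
  g : F ≃ₗ[Λ] SDual Λ F
  h_inl : ∀ x, h (LinearMap.inl Λ F (SDual Λ F) x) = LinearMap.inr Λ F (SDual Λ F) (g x)
  g' : F ≃ₗ[Λ] SDual Λ F
  h_symm_inl : ∀ x, (h.symm (LinearMap.inl Λ F (SDual Λ F) x)).2 = g' x
  A : E ≃ₗ[Λ] SDual Λ E
  T : E ≃ₗ[Λ] E
  w : E →ₗ[Λ] F × SDual Λ F
  ζ : F × SDual Λ F →ₗ[Λ] E
  A_sub : ∀ e e', hyp ε F (w e) (w e') = A e e' - A e (T e')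
  A_T_right : ∀ e e', A e (T e') = -(ε • star (A e' e))
  w_ζ : ∀ v, w (ζ v) = v - h.symm v
  A_ζ : ∀ v e, A (ζ v) e = hyp ε F v (w e)
  K : Submodule Λ E
  isDirectSummand_K : IsDirectSummand K
  mem_K : ∀ e, e ∈ K ↔ ∀ d ∈ K, A e d = 0
  T_mem_K : ∀ e, T e ∈ K ↔ e ∈ K

namespace TwistedDouble

variable {ε : ℤˣ} {E : Type u} [AddCommGroup E] [Module Λ E] (D : TwistedDouble Λ ε E F)

local notation "ι" => LinearMap.inl Λ F (SDual Λ F)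
local notation "κ" => LinearMap.inr Λ F (SDual Λ F)
local notation "Φ" => hyp ε F

/-- Exchanging the arguments twice by `A_T_right` cancels the signs and the involution, so `T` is an
isometry of `A`. -/
theorem A_T (e e' : E) : D.A (D.T e) (D.T e') = D.A e e' := by
  rw [D.A_T_right, D.A_T_right]
  rcases Int.units_eq_one_or ε with rfl | rfl <;> simp

/-- Used to remove `T` in the eliminations for `thdForm`: the term in `w (T σ)` corrects `A (T σ)`
to `A σ`. -/
theorem monodromy_apply (σ e : E) : D.A (D.T σ) e - Φ (D.w (D.T σ)) (D.w e) = D.A σ e := by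
  rw [D.A_sub, D.A_T, sub_sub_cancel]

theorem hyp_h_left (v v' : F × SDual Λ F) : Φ (D.h v) v' = Φ v (D.h.symm v') := by
  rw [← D.hyp_h v, LinearEquiv.apply_symm_apply]

/-- Apply `A + ε A* = w* Φ w` to the pair `(e, ζ v)`: the transposed term is `Φ(w e, v)` by the
variation property, and it cancels against the `v` in `w ζ v = v - h⁻¹ v`. -/
theorem A_ζ_right (e : E) (v : F × SDual Λ F) :
    D.A e (D.ζ v) = -Φ (D.w e) (D.h.symm v) := by
  have h := D.A_sub e (D.ζ v)
  rw [D.w_ζ, D.A_T_right, D.A_ζ, map_sub, hyp_symm ε (D.w e) v, sub_neg_eq_add, sub_eq_add_neg,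
    add_comm] at h
  exact (add_right_cancel h).symm

/-- Tested against `v`, the variation property turns `Φ(v, w T e)` into `A(ζ v, T e)`. Transposing
gives `A(e, ζ v)`, hence `Φ(h⁻¹ v, w e)`, and `h` is an isometry. -/
theorem w_T [Module.Free Λ F] [Module.Finite Λ F] (e : E) : D.w (D.T e) = D.h (D.w e) := by
  apply hyp_injective ε
  intro v
  rw [← D.A_ζ, D.A_T_right, D.A_ζ_right, ← hyp_h_left, hyp_symm ε v]
  rcases Int.units_eq_one_or ε with rfl | rfl <;> simp

theorem A_T_ζ [Module.Free Λ F] [Module.Finite Λ F] (v : F × SDual Λ F) (e : E) :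
    D.A (D.T (D.ζ v)) e = Φ v (D.h.symm (D.w e)) := by
  obtain ⟨e, rfl⟩ := D.T.surjective e
  rw [D.A_T, D.A_ζ, D.w_T, LinearEquiv.symm_apply_apply]

variable [Module.Free Λ E] [Module.Finite Λ E] [Module.Free Λ F] [Module.Finite Λ F]

/-! #### The form on `E ⊕ F` -/

/-- The form on `E ⊕ F`. -/
def fstForm : AsymForm Λ where
  M := E × F
  form := -bil D.A.toLinearMap (LinearMap.fst Λ E F) (LinearMap.fst Λ E F)
    + bil Φ (ι ∘ₗ (LinearMap.fst Λ F (SDual Λ F) ∘ₗ D.w ∘ₗ LinearMap.fst Λ E F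
        - LinearMap.snd Λ E F)) (D.w ∘ₗ LinearMap.fst Λ E F)
    + bil Φ (D.w ∘ₗ LinearMap.fst Λ E F) (ι ∘ₗ LinearMap.snd Λ E F)

theorem fstForm_apply (x x' : E × F) : D.fstForm.form x x' =
    -D.A x.1 x'.1 + Φ (ι ((D.w x.1).1 - x.2)) (D.w x'.1) + Φ (D.w x.1) (ι x'.2) := rfl

/-- By the variation property the form at `(e, x)` is the pair `A(-e + ζ y)`, `(w e).2` with `y = (w
e).1 - x`. If `e = ζ y - c` with `c` fixed, then `(w e).2 = -g' y - (w c).2`, so invertibility of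
`A` and of `g'` determines everything. -/
theorem fstForm_nonsingular : D.fstForm.Nonsingular := by
  have key : ∀ (e : E) (x : F) (x' : E × F), D.fstForm.form (e, x) x' =
      D.A (-e + D.ζ (ι ((D.w e).1 - x))) x'.1 + (D.w e).2 x'.2 := by
    intro e x x'
    rw [fstForm_apply, hyp_inl, map_add, SDual.add_apply, map_neg, SDual.neg_apply, D.A_ζ]
  constructor
  · refine (injective_iff_map_eq_zero D.fstForm.form).2 ?_
    rintro ⟨(e : E), (x : F)⟩ h0
    have h : ∀ x', D.fstForm.form (e, x) x' = 0 := fun x' => by rw [h0]; rfl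
    have h₁ : -e + D.ζ (ι ((D.w e).1 - x)) = 0 := by
      apply D.A.injective
      rw [map_zero]
      ext e'
      have := (key e x (e', 0)).symm.trans (h (e', 0))
      simpa using this
    have h₂ : (D.w e).2 = 0 := by
      ext x'
      have := (key e x (0, x')).symm.trans (h (0, x'))
      simpa using this
    have h₃ : e = D.ζ (ι ((D.w e).1 - x)) := by rwa [neg_add_eq_zero] at h₁
    have h₄ : (D.w e).1 - x = 0 := by
      have h₅ := congrArg D.w h₃
      rw [D.w_ζ] at h₅
      have h₆ := congrArg Prod.snd h₅
      rw [Prod.snd_sub, D.h_symm_inl, h₂] at h₆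
      apply D.g'.injective
      rw [map_zero, ← neg_eq_zero, ← zero_sub]
      exact h₆.symm
    rw [h₄, map_zero, map_zero] at h₃
    subst h₃
    rw [map_zero] at h₄
    have : x = 0 := by simpa using h₄
    rw [this]
    rfl
  · intro φ
    let φ₁ : SDual Λ E := dualMap (LinearMap.inl Λ E F) φ
    let φ₂ : SDual Λ F := dualMap (LinearMap.inr Λ E F) φ
    let c := D.A.symm φ₁
    -- The solution of `(w (ζ (ι y) - c)).2 = φ₂`.
    let y := D.g'.symm (-(φ₂ + (D.w c).2))
    let e : E := D.ζ (ι y) - c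
    have h₁ : (D.w e).2 = φ₂ := by
      change (D.w (D.ζ (ι y) - c)).2 = φ₂
      rw [map_sub, D.w_ζ, Prod.snd_sub, Prod.snd_sub, D.h_symm_inl, LinearEquiv.apply_symm_apply]
      simp
    refine ⟨((e, (D.w e).1 - y) : E × F), ?_⟩
    apply SDual.ext
    rintro ⟨(e' : E), (x' : F)⟩
    refine (key _ _ _).trans ?_
    rw [h₁, sub_sub_cancel]
    have h₂ : -e + D.ζ (ι y) = c := by
      change -(D.ζ (ι y) - c) + D.ζ (ι y) = c
      abel
    rw [h₂, LinearEquiv.apply_symm_apply]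
    exact SDual.apply_prod (M := E) φ e' x'

/-! #### The form on `(F ⊕ F*) ⊕ F*` -/

/-- The form on `(F ⊕ F*) ⊕ F*`. -/
def sndForm : AsymForm Λ where
  M := (F × SDual Λ F) × SDual Λ F
  form := bil Φ (LinearMap.fst Λ _ _) (LinearMap.fst Λ _ _ + κ ∘ₗ LinearMap.snd Λ _ _)
    + bil Φ (D.h.toLinearMap ∘ₗ (LinearMap.fst Λ _ _ + κ ∘ₗ LinearMap.snd Λ _ _))
        (LinearMap.fst Λ _ _)

/-! #### The metabolic form on `E ⊕ E ⊕ E` -/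

/-- The metabolic form on `E ⊕ E ⊕ E`. -/
def thdForm : AsymForm Λ where
  M := E × E × E
  form :=
    let x : E × E × E →ₗ[Λ] E := LinearMap.fst Λ _ _
    let y : E × E × E →ₗ[Λ] E := LinearMap.fst Λ _ _ ∘ₗ LinearMap.snd Λ _ _
    let z : E × E × E →ₗ[Λ] E := LinearMap.snd Λ _ _ ∘ₗ LinearMap.snd Λ _ _
    let T := D.T.toLinearMap
    let w := D.w
    bil D.A.toLinearMap (T ∘ₗ x) (y + z) - bil D.A.toLinearMap x y
      - bil D.A.toLinearMap (y + z) (T ∘ₗ x) + bil D.A.toLinearMap y y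
      + bil Φ (w ∘ₗ (z + T ∘ₗ z)) (w ∘ₗ z) + bil Φ (w ∘ₗ y) (w ∘ₗ z)
      + bil Φ (w ∘ₗ T ∘ₗ z) (w ∘ₗ y)

theorem thdForm_apply (x x' : E × E × E) : D.thdForm.form x x' =
    D.A (D.T x.1) (x'.2.1 + x'.2.2) - D.A x.1 x'.2.1 - D.A (x.2.1 + x.2.2) (D.T x'.1)
      + D.A x.2.1 x'.2.1 + Φ (D.w (x.2.2 + D.T x.2.2)) (D.w x'.2.2)
      + Φ (D.w x.2.1) (D.w x'.2.2) + Φ (D.w (D.T x.2.2)) (D.w x'.2.1) := rfl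

/-- The rows of the metabolic form. -/
theorem thdForm_rows (ξ a σ ξ' a' σ' : E) : D.thdForm.form (ξ, a, σ) (ξ', a', σ') =
    -D.A (a + σ) (D.T ξ')
      + (D.A (a - ξ) a' + D.A (D.T ξ) a' + Φ (D.w (D.T σ)) (D.w a'))
      + (D.A (D.T ξ) σ' + Φ (D.w (D.T σ)) (D.w σ') + Φ (D.w (a + σ)) (D.w σ')) := by
  rw [thdForm_apply]
  simp only [map_add, map_sub, SDual.add_apply, SDual.sub_apply]
  abel

/-- Elimination in the rows: the first determines `a + σ`, the difference of the other two then
determines `a - ξ`, and what remains of the last determines `σ` by `monodromy_apply`. -/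
theorem thdForm_nonsingular : D.thdForm.Nonsingular := by
  constructor
  · refine (injective_iff_map_eq_zero D.thdForm.form).2 ?_
    rintro ⟨(ξ : E), (a : E), (σ : E)⟩ h0
    have h : ∀ ξ' a' σ', D.thdForm.form (ξ, a, σ) (ξ', a', σ') = 0 :=
      fun _ _ _ => by rw [h0]; rfl
    simp only [thdForm_rows] at h
    have h₁ : a + σ = 0 := by
      apply D.A.injective
      ext e
      have := h (D.T.symm e) 0 0
      simp only [map_zero, add_zero, LinearEquiv.apply_symm_apply, neg_eq_zero] at this
      rw [this, map_zero, SDual.zero_apply]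
    have h₂ : a - ξ = 0 := by
      apply D.A.injective
      ext e
      have e₁ := h 0 e 0
      have e₂ := h 0 0 e
      rw [h₁] at e₁ e₂
      simp only [map_zero, SDual.zero_apply, neg_zero, zero_add, add_zero] at e₁ e₂ ⊢
      rw [add_assoc, e₂, add_zero] at e₁
      exact e₁
    have h₃ : ξ = -σ := by rw [← sub_eq_zero.1 h₂]; exact eq_neg_of_add_eq_zero_left h₁
    have h₄ : σ = 0 := by
      apply D.A.injective
      ext e
      have e₂ := h 0 0 e
      rw [h₁, h₃] at e₂
      simp only [map_zero, SDual.zero_apply, neg_zero, zero_add, add_zero, map_neg,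
        SDual.neg_apply] at e₂ ⊢
      rw [← D.monodromy_apply, sub_eq_zero]
      exact neg_add_eq_zero.1 e₂
    rw [h₄] at h₁ h₃
    rw [add_zero] at h₁
    rw [h₁, h₃, h₄, neg_zero]
    rfl
  · intro φ
    let φ₁ : SDual Λ E := dualMap (LinearMap.inl Λ E (E × E)) φ
    let φ₂ : SDual Λ E := dualMap (LinearMap.inr Λ E (E × E) ∘ₗ LinearMap.inl Λ E E) φ
    let φ₃ : SDual Λ E := dualMap (LinearMap.inr Λ E (E × E) ∘ₗ LinearMap.inr Λ E E) φ
    let S : E →ₗ[Λ] SDual Λ E := pull D.w Φ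
    -- Here `s` is the required value of `a + σ` and `k` that of `a - ξ`, which leads to the
    -- preimage `(s - σ - k, s - σ, σ)`.
    let s := D.A.symm (-dualMap D.T.symm.toLinearMap φ₁)
    let k := D.A.symm (φ₂ - φ₃ + S s)
    let σ := -D.A.symm (φ₃ - S s - D.A (D.T (s - k)))
    have hs : ∀ e, D.A s (D.T e) = -φ₁ e := by
      intro e
      change D.A (D.A.symm _) _ = _
      rw [LinearEquiv.apply_symm_apply]
      simp
    have hk : ∀ e, D.A k e = φ₂ e - φ₃ e + S s e := by
      intro e
      change D.A (D.A.symm _) _ = _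
      rw [LinearEquiv.apply_symm_apply]
      rfl
    have hσ : ∀ e, D.A σ e = -(φ₃ e - S s e - D.A (D.T (s - k)) e) := by
      intro e
      change D.A (-D.A.symm _) _ = _
      rw [map_neg, LinearEquiv.apply_symm_apply]
      rfl
    refine ⟨((s - σ - k, s - σ, σ) : E × E × E), ?_⟩
    apply SDual.ext
    rintro ⟨(ξ' : E), (a' : E), (σ' : E)⟩
    refine (D.thdForm_rows _ _ _ _ _ _).trans ?_
    have h₃ : D.A (D.T (s - σ - k)) σ' + Φ (D.w (D.T σ)) (D.w σ') + Φ (D.w (s - σ + σ)) (D.w σ')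
        = φ₃ σ' := by
      have e₁ := D.monodromy_apply σ σ'
      have e₂ := hσ σ'
      rw [← e₁] at e₂
      change _ = -(φ₃ σ' - Φ (D.w s) (D.w σ') - D.A (D.T (s - k)) σ') at e₂
      rw [sub_add_cancel, sub_right_comm, map_sub D.T, map_sub D.A, SDual.sub_apply]
      rw [sub_eq_iff_eq_add] at e₂
      rw [e₂]
      abel
    have h₂ : D.A (s - σ - (s - σ - k)) a' + D.A (D.T (s - σ - k)) a' +
        Φ (D.w (D.T σ)) (D.w a') = φ₂ a' := by
      have e₁ := D.monodromy_apply σ a'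
      have e₂ := hσ a'
      rw [← e₁] at e₂
      change _ = -(φ₃ a' - Φ (D.w s) (D.w a') - D.A (D.T (s - k)) a') at e₂
      have e₃ := hk a'
      change _ = φ₂ a' - φ₃ a' + Φ (D.w s) (D.w a') at e₃
      rw [sub_sub_cancel, sub_right_comm s, map_sub D.T, map_sub D.A, SDual.sub_apply, e₃]
      rw [sub_eq_iff_eq_add] at e₂
      rw [e₂]
      abel
    rw [h₂, h₃, sub_add_cancel, hs, neg_neg]
    refine Eq.trans ?_ (SDual.apply_prod (M := E) (N := E × E) φ ξ' (a', σ'))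
    rw [add_assoc]
    exact congrArg (_ + ·) (SDual.apply_prod (dualMap (LinearMap.inr Λ E (E × E)) φ) a' σ')

/-- The entries are built from `A`, `T` and `w* Φ w = A (1 - T)`, and these vanish on the `T`-stable
lagrangian `K`. Conversely, the elimination that proves non-singularity works modulo `K`, with the
lagrangian property `mem_K` in place of injectivity of `A`. -/
theorem thdForm_metabolic : D.thdForm.Metabolic := by
  refine ⟨D.thdForm_nonsingular, D.K.prod (D.K.prod D.K),
    D.isDirectSummand_K.prod (D.isDirectSummand_K.prod D.isDirectSummand_K), ?_⟩
  have hS : ∀ e e', e ∈ D.K → e' ∈ D.K → Φ (D.w e) (D.w e') = 0 := by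
    intro e e' he he'
    rw [D.A_sub, (D.mem_K e).1 he e' he', (D.mem_K e).1 he _ ((D.T_mem_K e').2 he'), sub_zero]
  rintro ⟨(ξ : E), (a : E), (σ : E)⟩
  constructor
  · rintro ⟨hξ, ha, hσ⟩ ⟨(ξ' : E), (a' : E), (σ' : E)⟩ ⟨hξ', ha', hσ'⟩
    simp only [SetLike.mem_coe] at hξ ha hσ hξ' ha' hσ'
    refine (D.thdForm_rows _ _ _ _ _ _).trans ?_
    have hTσ := (D.T_mem_K σ).2 hσ
    rw [(D.mem_K _).1 (add_mem ha hσ) _ ((D.T_mem_K ξ').2 hξ'),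
      (D.mem_K _).1 (sub_mem ha hξ) _ ha', (D.mem_K _).1 ((D.T_mem_K ξ).2 hξ) _ ha',
      (D.mem_K _).1 ((D.T_mem_K ξ).2 hξ) _ hσ', hS _ _ hTσ ha', hS _ _ hTσ hσ',
      hS _ _ (add_mem ha hσ) hσ']
    simp
  · intro h0
    have h : ∀ ξ' ∈ D.K, ∀ a' ∈ D.K, ∀ σ' ∈ D.K,
        D.thdForm.form (ξ, a, σ) (ξ', a', σ') = 0 :=
      fun ξ' hξ' a' ha' σ' hσ' => h0 (ξ', a', σ') ⟨hξ', ha', hσ'⟩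
    simp only [thdForm_rows] at h
    have h₁ : a + σ ∈ D.K := by
      rw [D.mem_K]
      intro d hd
      have := h (D.T.symm d) (by rwa [← D.T_mem_K, LinearEquiv.apply_symm_apply]) 0
        (zero_mem _) 0 (zero_mem _)
      simpa only [map_zero, add_zero, LinearEquiv.apply_symm_apply, neg_eq_zero] using this
    have h₂ : ∀ d ∈ D.K, D.A (D.T ξ) d + Φ (D.w (D.T σ)) (D.w d) = 0 := by
      intro d hd
      have := h 0 (zero_mem _) 0 (zero_mem _) d hd
      simpa only [map_zero, neg_zero, zero_add, add_zero, hS _ _ h₁ hd] using this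
    have h₃ : a - ξ ∈ D.K := by
      rw [D.mem_K]
      intro d hd
      have := h 0 (zero_mem _) d hd 0 (zero_mem _)
      rw [add_assoc (D.A (a - ξ) d), h₂ d hd] at this
      simpa using this
    have h₄ : ξ + σ ∈ D.K := by
      have := sub_mem h₁ h₃
      rwa [show a + σ - (a - ξ) = ξ + σ by abel] at this
    have h₅ : σ ∈ D.K := by
      rw [D.mem_K]
      intro d hd
      have e₁ := (D.mem_K _).1 ((D.T_mem_K _).2 h₄) d hd
      rw [map_add, map_add, SDual.add_apply] at e₁
      rw [← D.monodromy_apply, eq_neg_of_add_eq_zero_right e₁, eq_neg_of_add_eq_zero_left (h₂ d hd)]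
      abel
    have h₆ : ξ ∈ D.K := by simpa using sub_mem h₄ h₅
    have h₇ : a ∈ D.K := by simpa using sub_mem h₁ h₅
    exact ⟨h₆, h₇, h₅⟩

end TwistedDouble

end TwistedDouble

namespace TwistedDouble

variable {Λ : Type u} [Ring Λ] [StarRing Λ] {F : Type u} [AddCommGroup F] [Module Λ F]
variable {ε : ℤˣ} {E : Type u} [AddCommGroup E] [Module Λ E] (D : TwistedDouble Λ ε E F)
variable [Module.Free Λ E] [Module.Finite Λ E] [Module.Free Λ F] [Module.Finite Λ F]

local notation "ι" => LinearMap.inl Λ F (SDual Λ F)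
local notation "κ" => LinearMap.inr Λ F (SDual Λ F)
local notation "Φ" => hyp ε F

/-! #### The lagrangian of the sum of the three forms -/

/-- The form `fstForm - sndForm + thdForm`. -/
def total : AsymForm Λ := (D.fstForm.sum D.sndForm.neg).sum D.thdForm

/-- The underlying module of `total`. -/
abbrev Total (_ : TwistedDouble Λ ε E F) : Type u :=
  ((E × F) × ((F × SDual Λ F) × SDual Λ F)) × (E × E × E)

/-- The form of `total`. -/
def totalForm (x x' : D.Total) : Λ :=
  -D.A x.1.1.1 x'.1.1.1 + Φ (ι ((D.w x.1.1.1).1 - x.1.1.2)) (D.w x'.1.1.1)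
    + Φ (D.w x.1.1.1) (ι x'.1.1.2)
    - (Φ x.1.2.1 (x'.1.2.1 + κ x'.1.2.2) + Φ (D.h (x.1.2.1 + κ x.1.2.2)) x'.1.2.1)
    + (-D.A (x.2.2.1 + x.2.2.2) (D.T x'.2.1)
      + (D.A (x.2.2.1 - x.2.1) x'.2.2.1 + D.A (D.T x.2.1) x'.2.2.1
        + Φ (D.w (D.T x.2.2.2)) (D.w x'.2.2.1))
      + (D.A (D.T x.2.1) x'.2.2.2 + Φ (D.w (D.T x.2.2.2)) (D.w x'.2.2.2)
        + Φ (D.w (x.2.2.1 + x.2.2.2)) (D.w x'.2.2.2)))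

theorem total_form (x x' : D.Total) : D.total.form x x' = D.totalForm x x' := by
  have h := D.thdForm_rows x.2.1 x.2.2.1 x.2.2.2 x'.2.1 x'.2.2.1 x'.2.2.2
  change D.fstForm.form x.1.1 x'.1.1 + -(D.sndForm.form x.1.2 x'.1.2) +
    D.thdForm.form (x.2.1, x.2.2.1, x.2.2.2) (x'.2.1, x'.2.2.1, x'.2.2.2) = _
  rw [h, ← sub_eq_add_neg]
  rfl

/-- The first generators of the lagrangian. -/
def lag₁ : F →ₗ[Λ] D.Total :=
  let m := LinearMap.fst Λ F (SDual Λ F) ∘ₗ D.h.symm.toLinearMap ∘ₗ ι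
  let n := LinearMap.snd Λ F (SDual Λ F) ∘ₗ D.h.symm.toLinearMap ∘ₗ ι
  let g := D.g.toLinearMap
  (((-(D.ζ ∘ₗ ι)).prod (LinearMap.id + m)).prod
    ((LinearMap.id.prod (-g - g ∘ₗ m)).prod (g + g ∘ₗ m - n))).prod 0

/-- The second generators of the lagrangian. -/
def lag₂ : F →ₗ[Λ] D.Total :=
  let g := D.g.toLinearMap
  ((LinearMap.prod 0 (-LinearMap.id)).prod ((LinearMap.prod 0 g).prod (-g))).prod
    ((D.ζ ∘ₗ ι).prod 0)

/-- The third generators of the lagrangian. -/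
def lag₃ : E × E →ₗ[Λ] D.Total :=
  let a : E × E →ₗ[Λ] E := LinearMap.fst Λ E E
  let σ : E × E →ₗ[Λ] E := LinearMap.snd Λ E E
  let p := LinearMap.fst Λ F (SDual Λ F) ∘ₗ D.w ∘ₗ a
  let q := LinearMap.snd Λ F (SDual Λ F) ∘ₗ D.w ∘ₗ a
  let g := D.g.toLinearMap
  ((a.prod p).prod ((D.w ∘ₗ σ + D.w ∘ₗ a - κ ∘ₗ g ∘ₗ p).prod (g ∘ₗ p - q))).prod
    (LinearMap.prod 0 (a.prod σ))

/-- The parametrisation of the lagrangian. -/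
def lag : F × F × E × E →ₗ[Λ] D.Total := D.lag₁.coprod (D.lag₂.coprod D.lag₃)

/-- The parametrisation of a complement of the lagrangian. -/
def colag : E × SDual Λ F × SDual Λ F × E →ₗ[Λ] D.Total :=
  let e := LinearMap.fst Λ E (SDual Λ F × SDual Λ F × E)
  let t := LinearMap.snd Λ E (SDual Λ F × SDual Λ F × E)
  let v := LinearMap.fst Λ (SDual Λ F) (SDual Λ F × E)
  let s := LinearMap.snd Λ (SDual Λ F) (SDual Λ F × E)
  ((e.prod 0).prod ((κ ∘ₗ v ∘ₗ t).prod (LinearMap.fst Λ (SDual Λ F) E ∘ₗ s ∘ₗ t))).prod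
    ((LinearMap.snd Λ (SDual Λ F) E ∘ₗ s ∘ₗ t).prod 0)

/-- Since `h ι p = κ g p`, orthogonality to these generators is the one condition `(w e).2 + q = g
p` on `x = (((e, p), (v, q)), (ξ, a, σ))`. -/
theorem totalForm_lag₁ (x : D.Total) (x' : F) : D.totalForm x (D.lag₁ x') =
    Φ (D.w x.1.1.1 + κ x.1.2.2 - D.h (ι x.1.1.2)) (ι x') := by
  obtain ⟨⟨⟨e, p⟩, v, q⟩, ξ, a, σ⟩ := x
  obtain ⟨m, hm⟩ : ∃ m, m = (D.h.symm (ι x')).1 := ⟨_, rfl⟩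
  obtain ⟨n, hn⟩ : ∃ n, n = (D.h.symm (ι x')).2 := ⟨_, rfl⟩
  have hmn : D.h.symm (ι x') = ι m + κ n := by rw [hm, hn]; simp
  have hl : D.lag₁ x' = (((-D.ζ (ι x'), x' + m), (ι x' - κ (D.g x') - κ (D.g m),
      D.g x' + D.g m - n)), 0) := by
    rw [hm, hn]
    ext <;> simp [lag₁]
  have h₁ : Φ (D.w e) (κ n) = Φ (ι (D.w e).1) (κ n) := by
    rw [hyp_eq_add]
    change _ + Φ (D.w e) (ι 0) = _
    rw [map_zero, map_zero, add_zero]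
  rw [hl]
  simp only [totalForm, map_zero, ← D.h_inl, D.hyp_h_left, D.w_ζ, D.A_ζ_right, hmn, map_add, map_sub,
    map_neg, SDual.add_apply, SDual.sub_apply, hyp_inl_inl, hyp_inr_inr,
    LinearEquiv.symm_apply_apply, Prod.fst_zero, Prod.snd_zero, h₁]
  abel

/-- In the same coordinates, orthogonality to these generators says that `w (a + σ)` and `w e + v +
κ q` have equal `F*`-components. -/
theorem totalForm_lag₂ (x : D.Total) (x' : F) : D.totalForm x (D.lag₂ x') =
    Φ (D.w (x.2.2.1 + x.2.2.2) - D.w x.1.1.1 - x.1.2.1 - κ x.1.2.2) (ι x') := by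
  obtain ⟨⟨⟨e, p⟩, v, q⟩, ξ, a, σ⟩ := x
  have hl : D.lag₂ x' = (((0, -x'), (κ (D.g x'), -D.g x')), (D.ζ (ι x'), 0, 0)) := by
    ext <;> simp [lag₂]
  have h₁ : ∀ e, D.A e (D.T (D.ζ (ι x'))) = -Φ (D.w e) (ι x') := by
    intro e
    rw [D.A_T_right, D.A_ζ, ← hyp_symm]
  rw [hl]
  simp only [totalForm, map_zero, ← D.h_inl, D.hyp_h_left, h₁, map_add, map_sub,
    map_neg, SDual.add_apply, SDual.sub_apply, SDual.neg_apply,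
    LinearEquiv.symm_apply_apply, Prod.fst_zero, Prod.snd_zero]
  abel

/-- The pairing is brought to a form in which the isometry occurs only as `h⁻¹` in the right
argument: `κ g` is written as `h ι`, and `w T` as `h w`. -/
theorem totalForm_lag₃ (x : D.Total) (a' σ' : E) : D.totalForm x (D.lag₃ (a', σ')) =
    -D.A x.1.1.1 a' + Φ (ι ((D.w x.1.1.1).1 - x.1.1.2)) (D.w a')
      + Φ (D.w x.1.1.1) (ι (D.w a').1)
      - (Φ x.1.2.1 (D.w σ' + ι (D.w a').1)
        + Φ (x.1.2.1 + κ x.1.2.2) (D.h.symm (D.w σ' + D.w a') - ι (D.w a').1))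
      + (D.A (x.2.2.1 - x.2.1) a' + D.A (D.T x.2.1) a' + Φ (D.w x.2.2.2) (D.h.symm (D.w a'))
      + (D.A (D.T x.2.1) σ' + Φ (D.w x.2.2.2) (D.h.symm (D.w σ'))
        + Φ (D.w (x.2.2.1 + x.2.2.2)) (D.w σ'))) := by
  obtain ⟨⟨⟨e, p⟩, v, q⟩, ξ, a, σ⟩ := x
  have hl : D.lag₃ (a', σ') = (((a', (D.w a').1),
      (D.w σ' + D.w a' - κ (D.g (D.w a').1), D.g (D.w a').1 - (D.w a').2)), (0, a', σ')) := by
    ext <;> simp [lag₃]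
  have h₁ : κ (D.w a').2 = D.w a' - ι (D.w a').1 := by
    ext <;> simp
  rw [hl]
  simp only [totalForm, map_zero, map_sub κ, h₁, ← D.h_inl, D.hyp_h_left, D.w_T, map_add, map_sub,
    map_neg, SDual.add_apply, SDual.sub_apply, LinearEquiv.symm_apply_apply]
  abel

theorem totalForm_add_right (x y z : D.Total) :
    D.totalForm x (y + z) = D.totalForm x y + D.totalForm x z := by
  rw [← total_form, ← total_form, ← total_form]
  exact map_add (D.total.form x) y z

theorem lag_apply (x y : F) (e : E × E) : D.lag (x, y, e) = D.lag₁ x + (D.lag₂ y + D.lag₃ e) := rfl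

/-- All three families solve the linear conditions given by the first two. The pairing with the
third is reduced to terms `Φ(ι _, _)` and `Φ(w _, _)`, in which everything cancels. -/
theorem totalForm_lag (x y : F × F × E × E) : D.totalForm (D.lag x) (D.lag y) = 0 := by
  obtain ⟨x, p, a, σ⟩ := x
  obtain ⟨x', p', a', σ'⟩ := y
  obtain ⟨m, hm⟩ : ∃ m, m = (D.h.symm (ι x)).1 := ⟨_, rfl⟩
  obtain ⟨n, hn⟩ : ∃ n, n = (D.h.symm (ι x)).2 := ⟨_, rfl⟩
  have hmn : D.h.symm (ι x) = ι m + κ n := by rw [hm, hn]; simp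
  have h₁ : D.lag₁ x = (((-D.ζ (ι x), x + m), (ι x - κ (D.g x) - κ (D.g m),
      D.g x + D.g m - n)), 0) := by
    rw [hm, hn]
    ext <;> simp [lag₁]
  have h₂ : D.lag₂ p = (((0, -p), (κ (D.g p), -D.g p)), (D.ζ (ι p), 0, 0)) := by
    ext <;> simp [lag₂]
  have h₃ : D.lag₃ (a, σ) = (((a, (D.w a).1),
      (D.w σ + D.w a - κ (D.g (D.w a).1), D.g (D.w a).1 - (D.w a).2)), (0, a, σ)) := by
    ext <;> simp [lag₃]
  have hw : ∀ a, κ (D.w a).2 = D.w a - ι (D.w a).1 := by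
    intro a
    ext <;> simp
  rw [D.lag_apply x' p', totalForm_add_right, totalForm_add_right]
  have e₁ : D.totalForm (D.lag (x, p, a, σ)) (D.lag₁ x') = 0 := by
    rw [totalForm_lag₁, lag_apply, h₁, h₂, h₃]
    simp only [Prod.fst_add, Prod.snd_add, map_add, map_sub, map_neg, map_zero, hw, ← D.h_inl,
      D.w_ζ, hmn, SDual.add_apply, SDual.sub_apply, SDual.neg_apply, SDual.zero_apply,
      hyp_inl_inl, Prod.fst_zero, Prod.snd_zero]
    abel
  have e₂ : D.totalForm (D.lag (x, p, a, σ)) (D.lag₂ p') = 0 := by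
    rw [totalForm_lag₂, lag_apply, h₁, h₂, h₃]
    simp only [Prod.fst_add, Prod.snd_add, map_add, map_sub, map_neg, map_zero, hw, ← D.h_inl,
      D.w_ζ, hmn, SDual.add_apply, SDual.sub_apply, SDual.neg_apply, SDual.zero_apply,
      hyp_inl_inl, Prod.fst_zero, Prod.snd_zero]
    abel
  -- This is `ι m + κ n = h⁻¹ ι x` paired with `h⁻¹ y`.
  have h₄ : ∀ y, Φ (κ n) (D.h.symm y) = Φ (ι x) y - Φ (ι m) (D.h.symm y) := by
    intro y
    rw [← D.hyp_h_left, ← D.hyp_h_left, eq_sub_iff_add_eq, add_comm, ← SDual.add_apply, ← map_add,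
      ← map_add, ← hmn, LinearEquiv.apply_symm_apply]
  -- As `h ι y` lies in `F*`, it sees only the `F`-component of `w a`.
  have h₅ : ∀ y a, Φ (ι y) (D.h.symm (D.w a)) = Φ (ι y) (D.h.symm (ι (D.w a).1)) := by
    intro y a
    rw [← D.hyp_h_left, ← D.hyp_h_left, D.h_inl, hyp_inr_left, hyp_inr_left]
    rfl
  have h₆ : ∀ y, (ι y).1 = y := fun _ => rfl
  have h₇ : ∀ y, (κ y).1 = 0 := fun _ => rfl
  have e₃ : D.totalForm (D.lag (x, p, a, σ)) (D.lag₃ (a', σ')) = 0 := by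
    rw [totalForm_lag₃, lag_apply, h₁, h₂, h₃]
    simp only [Prod.fst_add, Prod.snd_add, map_add, map_sub, map_neg, map_zero, hw, ← D.h_inl,
      D.w_ζ, hmn, SDual.add_apply, SDual.sub_apply, SDual.neg_apply, SDual.zero_apply,
      hyp_inl_inl, Prod.fst_zero, Prod.snd_zero, D.A_ζ, D.hyp_h_left, D.A_T_ζ, h₄, Prod.fst_neg,
      Prod.fst_sub, h₆, h₇]
    simp only [h₅]
    abel
  rw [e₁, e₂, e₃, add_zero, add_zero]

theorem colag_apply (e : E) (v q : SDual Λ F) (ξ : E) :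
    D.colag (e, v, q, ξ) = (((e, 0), (κ v, q)), (ξ, 0, 0)) := rfl

/-- An element of the lagrangian is determined by its coordinates `p`, `v.1`, `a`, `σ`, so the
elements where these vanish form a complement. On it, orthogonality to the generators successively
kills `v`, `e`, `q` and `ξ`. -/
theorem total_metabolic (h : D.sndForm.Nonsingular) : D.total.Metabolic := by
  refine ⟨(D.fstForm_nonsingular.sum h.neg).sum D.thdForm_nonsingular, _,
    AsymForm.isLagrangian_range (A := D.total) D.lag D.colag ?_ ?_ ?_⟩
  · intro x y
    exact (D.total_form _ _).trans (D.totalForm_lag x y)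
  · intro (x : D.Total)
    obtain ⟨⟨⟨e, p⟩, v, q⟩, ξ, a, σ⟩ := x
    -- The parameters `x` and `p₀` are forced by the coordinates `v.1` and `p`, once the
    -- contribution of `lag₃` is subtracted.
    let x := v.1 - (D.w σ).1 - (D.w a).1
    let p₀ := x + (D.h.symm (ι x)).1 + (D.w a).1 - p
    let d := (((e, p), (v, q)), (ξ, a, σ)) - D.lag (x, p₀, a, σ)
    refine ⟨(x, p₀, a, σ), (d.1.1.1, d.1.2.1.2, d.1.2.2, d.2.1), ?_⟩
    have hd : d = D.colag (d.1.1.1, d.1.2.1.2, d.1.2.2, d.2.1) := by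
      rw [colag_apply]
      have h₁ : d.1.1.2 = 0 := by
        simp [d, lag_apply, lag₁, lag₂, lag₃, p₀]
        abel
      have h₂ : d.1.2.1.1 = 0 := by
        simp [d, lag_apply, lag₁, lag₂, lag₃, x]
      have h₃ : d.2.2.1 = 0 := by simp [d, lag_apply, lag₁, lag₂, lag₃]
      have h₄ : d.2.2.2 = 0 := by simp [d, lag_apply, lag₁, lag₂, lag₃]
      rw [← h₁]
      refine Prod.ext (Prod.ext rfl (Prod.ext (Prod.ext ?_ ?_) rfl))
        (Prod.ext rfl (Prod.ext h₃ h₄))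
      · simpa using h₂
      · simp
    exact (congrArg (fun y : D.Total => D.lag (x, p₀, a, σ) + y) hd.symm).trans
      (add_sub_cancel (D.lag (x, p₀, a, σ)) _)
  · rintro ⟨(e : E), (v : SDual Λ F), (q : SDual Λ F), (ξ : E)⟩ h0
    have h : ∀ x p a σ, D.totalForm (((e, 0), (κ v, q)), (ξ, 0, 0)) (D.lag (x, p, a, σ)) = 0 :=
      fun x p a σ => (D.total_form _ _).symm.trans (h0 (x, p, a, σ))
    have h₁ : (D.w e).2 + q = 0 := by
      ext x
      have := h x 0 0 0
      rw [lag_apply, map_zero, Prod.mk_zero_zero, map_zero, add_zero, add_zero, totalForm_lag₁,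
        hyp_inl, map_zero, map_zero, sub_zero] at this
      exact this
    have h₂ : v = 0 := by
      ext x
      have := h 0 x 0 0
      rw [lag_apply, map_zero, Prod.mk_zero_zero, map_zero, add_zero, zero_add, totalForm_lag₂,
        hyp_inl] at this
      simp only [map_zero, Prod.snd_sub, zero_sub, add_zero, LinearMap.inr_apply] at this
      rw [eq_neg_of_add_eq_zero_left h₁] at this
      simpa using this
    have h' : ∀ a σ, D.totalForm (((e, 0), (κ v, q)), (ξ, 0, 0)) (D.lag₃ (a, σ)) = 0 := by
      intro a σ
      have := h 0 0 a σ
      rwa [lag_apply, map_zero, map_zero, zero_add, zero_add] at this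
    simp only [totalForm_lag₃, h₂, map_zero, SDual.zero_apply, zero_add, add_zero, sub_zero,
      zero_sub, map_add, map_sub, SDual.add_apply, map_neg, SDual.neg_apply] at h'
    -- The generators `lag₃ (0, b)`. Replacing `b` by `T b` next removes `T` and `h⁻¹`.
    have h₃ : ∀ b, D.A (D.T ξ) b = Φ (κ q) (D.h.symm (D.w b)) := by
      intro b
      have := h' 0 b
      simp only [map_zero, SDual.zero_apply, zero_add, add_zero, sub_zero, neg_zero,
        Prod.fst_zero] at this
      rw [zero_sub] at this
      exact (neg_add_eq_zero.1 this).symm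
    have h₄ : ∀ b, D.A ξ b = Φ (κ q) (D.w b) := by
      intro b
      rw [← D.A_T, h₃, D.w_T, LinearEquiv.symm_apply_apply]
    -- In the pairing with `lag₃ (b, 0)` the terms in `ξ` and `q` cancel, and `A_sub` turns the rest
    -- into `-A(e, T b)`.
    have h₅ : e = 0 := by
      apply D.A.injective
      ext b
      obtain ⟨b, rfl⟩ := D.T.surjective b
      have e₁ := h' b 0
      have e₂ := D.A_sub e b
      have e₃ : Φ (κ q) (D.w b) = Φ (κ q) (ι (D.w b).1) := by
        rw [hyp_inr_left, hyp_inr_left]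
        rfl
      rw [hyp_eq_add] at e₂
      simp only [h₃, h₄, e₃, map_zero, SDual.zero_apply, zero_add, add_zero] at e₁
      rw [map_zero, SDual.zero_apply, ← sub_sub_cancel (D.A e b) (D.A e (D.T b)), ← e₂,
        ← neg_eq_zero, ← e₁]
      abel
    have h₆ : q = 0 := by rw [h₅] at h₁; simpa using h₁
    have h₇ : ξ = 0 := by
      apply D.A.injective
      ext b
      rw [h₄, h₆, map_zero, map_zero, map_zero]
      rfl
    rw [h₅, h₂, h₆, h₇]
    rfl

theorem fstForm_wittEquiv (h : D.sndForm.Nonsingular) : D.fstForm.WittEquiv D.sndForm :=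
  AsymForm.wittEquiv_of_metabolic h D.thdForm_metabolic (D.total_metabolic h)

end TwistedDouble

/-! ### Duals of isomorphisms, monodromy, and the inverse of the hyperbolic form -/

section Duality

variable {Λ : Type u} [Ring Λ] [StarRing Λ]
variable {M N : Type u} [AddCommGroup M] [Module Λ M] [AddCommGroup N] [Module Λ N]
variable {F : Type u} [AddCommGroup F] [Module Λ F] [Module.Free Λ F] [Module.Finite Λ F]

theorem apply_coadj [Module.Free Λ M] [Module.Finite Λ M] (f : SDual Λ M →ₗ[Λ] N)
    (φ : SDual Λ M) (χ : SDual Λ N) : φ (coadj f χ) = star (χ (f φ)) := by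
  have h : ev Λ M (coadj f χ) = dualMap f χ := (evEquiv Λ M).apply_symm_apply _
  rw [← star_star (φ _), ← ev_apply, h, dualMap_apply]

theorem coadj_zero [Module.Free Λ M] [Module.Finite Λ M] :
    coadj (0 : SDual Λ M →ₗ[Λ] N) = 0 := by
  ext χ
  apply (evEquiv Λ M).injective
  rw [LinearMap.zero_apply, map_zero]
  refine ((evEquiv Λ M).apply_symm_apply _).trans ?_
  ext φ
  exact map_zero χ

theorem apply_evEquiv_symm [Module.Free Λ M] [Module.Finite Λ M] (φ : SDual Λ M)
    (χ : SDual Λ (SDual Λ M)) : φ ((evEquiv Λ M).symm χ) = star (χ φ) := by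
  have h : ev Λ M ((evEquiv Λ M).symm χ) = χ := (evEquiv Λ M).apply_symm_apply _
  rw [← star_star (φ _), ← ev_apply, h]

theorem eq_of_forall_dual [Module.Free Λ M] [Module.Finite Λ M] {x y : M}
    (h : ∀ φ : SDual Λ M, φ x = φ y) : x = y := by
  apply (ev_bijective (Λ := Λ)).1
  ext φ
  rw [ev_apply, ev_apply, h]

/-- The dual of an isomorphism. -/
def dualEquiv (f : M ≃ₗ[Λ] N) : SDual Λ N ≃ₗ[Λ] SDual Λ M :=
  LinearEquiv.ofLinearMap (dualMap f.toLinearMap) (dualMap f.symm.toLinearMap)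
    (by ext φ x; simp) (by ext φ x; simp)

/-- The dual of an isomorphism `M ≅ N*`. -/
noncomputable def adjEquiv [Module.Free Λ N] [Module.Finite Λ N] (f : M ≃ₗ[Λ] SDual Λ N) :
    N ≃ₗ[Λ] SDual Λ M := evEquiv Λ N ≪≫ₗ dualEquiv f

/-- Multiplication by a sign. -/
def signEquiv (ε : ℤˣ) (M : Type u) [AddCommGroup M] [Module Λ M] : M ≃ₗ[Λ] M :=
  LinearEquiv.ofLinearMap (ε • LinearMap.id) (ε • LinearMap.id)
    (by ext; simp [smul_smul]) (by ext; simp [smul_smul])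

/-- The monodromy `T = - ε A^{-*} A` of a non-singular form `A`. -/
noncomputable def monodromy [Module.Free Λ M] [Module.Finite Λ M] (ε : ℤˣ)
    (A : M ≃ₗ[Λ] SDual Λ M) : M ≃ₗ[Λ] M :=
  A ≪≫ₗ signEquiv (-ε) _ ≪≫ₗ (adjEquiv A).symm

theorem apply_monodromy [Module.Free Λ M] [Module.Finite Λ M] (ε : ℤˣ)
    (A : M ≃ₗ[Λ] SDual Λ M) (x y : M) : A x (monodromy ε A y) = -(ε • star (A y x)) := by
  have h : adj A.toLinearMap (monodromy ε A y) = (-ε) • A y :=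
    (adjEquiv A).apply_symm_apply _
  rw [← star_star (A x _)]
  change star (adj A.toLinearMap (monodromy ε A y) x) = _
  rw [h]
  rcases Int.units_eq_one_or ε with rfl | rfl <;> simp

/-- The inverse of the hyperbolic form. -/
noncomputable def hypInv (ε : ℤˣ) (F : Type u) [AddCommGroup F] [Module Λ F] [Module.Free Λ F]
    [Module.Finite Λ F] : SDual Λ (F × SDual Λ F) →ₗ[Λ] F × SDual Λ F :=
  ((ε • LinearMap.snd Λ (SDual Λ F) F).prod (LinearMap.fst Λ (SDual Λ F) F)) ∘ₗ
    (dualHyp Λ F).toLinearMap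

theorem hyp_hypInv (ε : ℤˣ) (φ : SDual Λ (F × SDual Λ F)) : hyp ε F (hypInv ε F φ) = φ := by
  have h : ∀ y, y (dualHyp Λ F φ).2 = star (φ (0, y)) := by
    intro y
    exact apply_evEquiv_symm y (dualMap (LinearMap.inr Λ F (SDual Λ F)) φ)
  ext ⟨x, y⟩
  rw [hyp_apply, ← SDual.apply_prod φ x y]
  change φ (x, 0) + ε • star (y (ε • (dualHyp Λ F φ).2)) = _
  congr 1
  rcases Int.units_eq_one_or ε with rfl | rfl <;> simp [h]

theorem hypInv_hyp (ε : ℤˣ) (v : F × SDual Λ F) : hypInv ε F (hyp ε F v) = v := by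
  apply hyp_injective ε
  intro x
  rw [hyp_symm, hyp_hypInv, ← hyp_symm]

theorem dualHyp_hyp_fst (ε : ℤˣ) (v : F × SDual Λ F) : (dualHyp Λ F (hyp ε F v)).1 = v.2 :=
  congrArg Prod.snd (hypInv_hyp ε v)

theorem blk_id (p : SDual Λ F × F) :
    (blk 0 0 LinearMap.id 0 : SDual Λ F × F →ₗ[Λ] F × SDual Λ F) p =
      LinearMap.inr Λ F (SDual Λ F) p.1 :=
  Prod.ext (add_zero _) (add_zero _)

theorem dualHyp_fst (φ : SDual Λ (F × SDual Λ F)) (x : F) :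
    (dualHyp Λ F φ).1 x = φ (LinearMap.inl Λ F (SDual Λ F) x) := rfl

end Duality

/-! ### The isometry of the hyperbolic form defined by a flip-isomorphism -/

section Flip

variable {Λ : Type u} [Ring Λ] [StarRing Λ]
variable {F G : Type u} [AddCommGroup F] [Module Λ F] [Module.Free Λ F] [Module.Finite Λ F]
  [AddCommGroup G] [Module Λ G] [Module.Free Λ G] [Module.Finite Λ G]
variable {ε : ℤˣ} {z : Preformation Λ ε F G} (t : FlipIso z)

local notation "ι" => LinearMap.inl Λ F (SDual Λ F)
local notation "κ" => LinearMap.inr Λ F (SDual Λ F)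
local notation "Φ" => hyp ε F

theorem adj_invStar (α : F ≃ₗ[Λ] SDual Λ F) (φ : SDual Λ F) :
    adj α.toLinearMap (invStar α φ) = φ := by
  ext x
  change star (α x (invStar α φ)) = φ x
  rw [apply_invStar, LinearEquiv.symm_apply_apply]

theorem invStar_adj (α : F ≃ₗ[Λ] SDual Λ F) (x : F) : invStar α (adj α.toLinearMap x) = x := by
  apply eq_of_forall_dual (Λ := Λ)
  intro φ
  rw [← star_star (φ _), apply_invStar]
  change star (star (α (α.symm φ) x)) = φ x
  rw [star_star, LinearEquiv.apply_symm_apply]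

/-- The isometry of the hyperbolic form given by a flip-isomorphism. -/
noncomputable def FlipIso.hypEquiv : (F × SDual Λ F) ≃ₗ[Λ] F × SDual Λ F :=
  LinearEquiv.ofLinearMap
    (blk 0 (invStar t.α) (ε • t.α.toLinearMap) (ε • (t.α.toLinearMap ∘ₗ symmDual ε t.ν)))
    (blk (-(symmDual ε t.ν ∘ₗ adj t.α.toLinearMap)) (ε • t.α.symm.toLinearMap)
      (adj t.α.toLinearMap) 0)
    (by
      apply LinearMap.ext
      rintro ⟨x, y⟩
      refine Prod.ext ?_ ?_
      · change 0 + invStar t.α (adj t.α.toLinearMap x + 0) = x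
        rw [add_zero, zero_add, invStar_adj]
      · change ε • t.α (-symmDual ε t.ν (adj t.α.toLinearMap x) + ε • t.α.symm y) +
          ε • t.α (symmDual ε t.ν (adj t.α.toLinearMap x + 0)) = y
        rcases Int.units_eq_one_or ε with rfl | rfl <;> simp)
    (by
      apply LinearMap.ext
      rintro ⟨x, y⟩
      refine Prod.ext ?_ ?_
      · change -symmDual ε t.ν (adj t.α.toLinearMap (0 + invStar t.α y)) +
          ε • t.α.symm (ε • t.α x + ε • t.α (symmDual ε t.ν y)) = x
        rw [zero_add, adj_invStar]
        rcases Int.units_eq_one_or ε with rfl | rfl <;> simp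
      · change adj t.α.toLinearMap (0 + invStar t.α y) + 0 = y
        rw [zero_add, add_zero, adj_invStar])

theorem FlipIso.hypEquiv_apply (v : F × SDual Λ F) :
    t.hypEquiv v = (invStar t.α v.2, ε • t.α v.1 + ε • t.α (symmDual ε t.ν v.2)) :=
  Prod.ext (zero_add _) rfl

theorem FlipIso.hypEquiv_symm_apply (v : F × SDual Λ F) :
    t.hypEquiv.symm v = (-symmDual ε t.ν (adj t.α.toLinearMap v.1) + ε • t.α.symm v.2,
      adj t.α.toLinearMap v.1) :=
  Prod.ext rfl (add_zero _)

/-- The blocks `α` and `α^{-*}` are mutually dual inverses, and the contributions of `ν* - ε ν`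
cancel because it is `(-ε)`-symmetric. -/
theorem FlipIso.hyp_hypEquiv (v v' : F × SDual Λ F) :
    Φ (t.hypEquiv v) (t.hypEquiv v') = Φ v v' := by
  have h₁ : ∀ x y, t.α x (invStar t.α y) = star (y x) := by
    intro x y
    rw [← star_star (t.α x _), apply_invStar, LinearEquiv.symm_apply_apply]
  have h₂ := apply_symmDual t.ν v.2 v'.2
  rw [hyp_apply, hyp_apply, t.hypEquiv_apply, t.hypEquiv_apply]
  rcases Int.units_eq_one_or ε with rfl | rfl <;> simp [h₁] at h₂ ⊢ <;> rw [h₂] <;> abel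

/-- The map `(γ; μ) : G → F ⊕ F*`. -/
def Preformation.incl (z : Preformation Λ ε F G) : G →ₗ[Λ] F × SDual Λ F := z.γ.prod z.μ

/-- The map `(μ* ε γ*) : F ⊕ F* → G*`. -/
def Preformation.proj (z : Preformation Λ ε F G) : F × SDual Λ F →ₗ[Λ] SDual Λ G :=
  LinearMap.coprod (adj z.μ) (ε • dualMap z.γ)

theorem Preformation.hyp_incl (v : F × SDual Λ F) (b : G) :
    Φ v (z.incl b) = ε • z.proj v b := by
  rw [hyp_apply]
  change v.2 (z.γ b) + ε • star (z.μ b v.1) =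
    ε • (adj z.μ v.1 + (ε • dualMap z.γ) v.2) b
  rcases Int.units_eq_one_or ε with rfl | rfl <;> simp [add_comm]

theorem Preformation.hyp_incl_left (b : G) (v : F × SDual Λ F) :
    Φ (z.incl b) v = star (z.proj v b) := by
  rw [hyp_symm, hyp_incl]
  rcases Int.units_eq_one_or ε with rfl | rfl <;> simp

/-- This is the `(-ε)`-symmetry of `γ* μ`. -/
theorem Preformation.hyp_incl_incl (b b' : G) : Φ (z.incl b) (z.incl b') = 0 := by
  have h := congrArg (fun φ : G →ₗ[Λ] SDual Λ G => φ b b') z.symm_eq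
  change z.μ b (z.γ b') = (-(ε • (adj z.μ ∘ₗ z.γ))) b b' at h
  rw [hyp_apply]
  change z.μ b (z.γ b') + ε • star (z.μ b' (z.γ b)) = 0
  rw [h]
  rcases Int.units_eq_one_or ε with rfl | rfl <;> simp

end Flip

/-! ### Extracting the needed equations from the homotopy `(Δ, η)` -/

section Homotopy

variable {Λ : Type u} [Ring Λ] [StarRing Λ]
variable {F G : Type u} [AddCommGroup F] [Module Λ F] [Module.Free Λ F] [Module.Finite Λ F]
  [AddCommGroup G] [Module Λ G] [Module.Free Λ G] [Module.Finite Λ G]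
variable {ε : ℤˣ} {z : Preformation Λ ε F G} {t : FlipIso z} {q : ℤ}

namespace SignatureData

variable (D : SignatureData q t)

local notation "ι" => LinearMap.inl Λ F (SDual Λ F)
local notation "κ" => LinearMap.inr Λ F (SDual Λ F)
local notation "Φ" => hyp ε F

/-- The component `Δ_{q+1} : F ⊕ F* → G`. -/
def Δ₁ : F × SDual Λ F →ₗ[Λ] G := (D.homotopy.Δ.hom 0 1).hom

/-- The component `Δ_q : G* → F ⊕ F*`. -/
def Δ₀ : SDual Λ G →ₗ[Λ] F × SDual Λ F := (D.homotopy.Δ.hom (Int.negSucc 0) 0).hom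

/-- The component `η_0 : C^{q+1} = G* → C_{q+1} = G`. -/
def η₀ : SDual Λ G →ₗ[Λ] G := D.homotopy.η 0 1 1

/-- The component `η_1 : C^{q+1} = G* → C_q = F ⊕ F*`. -/
def η₁ : SDual Λ G →ₗ[Λ] F × SDual Λ F := D.homotopy.η 1 1 0

/-- The component `η_1 : C^q → C_{q+1} = G`. -/
def η₁' : SDual Λ (F × SDual Λ F) →ₗ[Λ] G := D.homotopy.η 1 0 1

theorem cpx_d₁ (b : G) : ((cpx z).d 1 0).hom b = -(ε • z.incl b) := by
  have h₁ : (cpx z).d (0 + 1) 0 = cpxD z 0 := ChainComplex.of_d (cpxX Λ F G) (cpxD z) 0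
  refine (congrArg (fun f : cpxX Λ F G 1 ⟶ cpxX Λ F G 0 => f.hom b) h₁).trans ?_
  change ((-(ε • z.γ b), -(ε • z.μ b)) : F × SDual Λ F) = _
  rfl

theorem cpx_d₀ (v : F × SDual Λ F) : ((cpx z).d 0 (-1)).hom v = z.proj v := by
  have h₁ : (cpx z).d (-1 + 1) (-1) = cpxD z (-1) :=
    ChainComplex.of_d (cpxX Λ F G) (cpxD z) (-1)
  exact congrArg (fun f : cpxX Λ F G 0 ⟶ cpxX Λ F G (-1) => f.hom v) h₁

/-- The chain homotopy relation `β - 1 = Δ d` in the top degree `q + 1`. -/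
theorem Δ₁_incl (b : G) : D.Δ₁ (z.incl b) = ε • (b - t.β b) := by
  have h := D.homotopy.Δ.comm 1
  have h₂ : (cpx z).d 2 1 = 0 := ChainComplex.of_d (cpxX Λ F G) (cpxD z) 1
  rw [dNext_eq _ (show (ComplexShape.down ℤ).Rel 1 0 from rfl),
    prevD_eq _ (show (ComplexShape.down ℤ).Rel 2 1 from rfl), h₂, Limits.comp_zero, add_zero] at h
  have h' := congrArg (fun f : (cpx z).X 1 ⟶ (cpx z).X 1 => f.hom b) h
  change t.β b = D.Δ₁ (((cpx z).d 1 0).hom b) + b at h'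
  rw [cpx_d₁] at h'
  rcases Int.units_eq_one_or ε with rfl | rfl <;> simp at h' ⊢ <;> rw [h'] <;> abel

/-- The chain homotopy relation `h - 1 = Δ d + d Δ` in degree `q`. -/
theorem hypEquiv_eq (v : F × SDual Λ F) :
    t.hypEquiv v = D.Δ₀ (z.proj v) - ε • z.incl (D.Δ₁ v) + v := by
  have h := D.homotopy.Δ.comm 0
  rw [dNext_eq _ (show (ComplexShape.down ℤ).Rel 0 (-1) from rfl),
    prevD_eq _ (show (ComplexShape.down ℤ).Rel 1 0 from rfl)] at h
  have h' := congrArg (fun f : (cpx z).X 0 ⟶ (cpx z).X 0 => f.hom v) h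
  refine Eq.trans h' ?_
  rw [sub_eq_add_neg]
  exact congrArg₂ (fun a b : F × SDual Λ F => a + b + v) (congrArg D.Δ₀ (cpx_d₀ v))
    (cpx_d₁ (z := z) (D.Δ₁ v))

/-- The component `C^{q+1} → C_q` at `s = 0` of the equation for `η`. Neither `χ_t` nor `ψ_0 :
C^{q+1} → C_{q-1}` nor `ψ_1 : C^{q-1} → C_q` contributes, so of `Δ_% ψ` only the term `h ψ_0 Δ*` is
left. -/
theorem homotopy_eq₁ (hε : Int.negOnePow q = ε) (a : SDual Λ G) :
    -(ε • t.hypEquiv (κ (dualHyp Λ F (dualMap D.Δ₁ a)).1)) - ε • z.incl (D.η₀ a)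
      - (D.η₁ a - coadj D.η₁' a) = 0 := by
  have h := congrFun (congrFun (congrFun D.homotopy.eq 0) 1) 0
  have hψ₁ : cpxPsi z D.θ 0 1 (0 - 1) = 0 := rfl
  have hψ₂ : cpxPsi z D.θ 1 (0 - 1) (1 - 1) = 0 := rfl
  have hd : (cpx z).d (1 + 1) 1 = 0 := ChainComplex.of_d (cpxX Λ F G) (cpxD z) 1
  have hs₁ : Int.negOnePow (q + 0 + 1) = -ε := by
    rw [add_zero, Int.negOnePow_succ, hε]
  have hs₂ : Int.negOnePow ((q + 1) * (q + 0)) = 1 := by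
    rw [add_zero, mul_comm]
    exact Int.negOnePow_even _ (Int.even_mul_succ_self q)
  have hs₃ : Int.negOnePow (2 * q + 2 - (0 : ℕ) - 1) = -1 := by
    refine Int.negOnePow_odd _ ⟨q, ?_⟩
    push_cast
    ring
  change flipChi t D.θ D.ν D.κ 0 1 0 - 0 =
    -((D.homotopy.Δ.hom (0 - 1) 0).hom ∘ₗ cpxPsi z D.θ 0 1 (0 - 1) ∘ₗ dualMap _)
    + Int.negOnePow (q + 0 + 1) •
        ((((flipMap t).f 0).hom ∘ₗ cpxPsi z D.θ 0 (1 - 1) 0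
          + Int.negOnePow (2 * q) • ((D.homotopy.Δ.hom (0 - 1) 0).hom ∘ₗ
            (Int.negOnePow ((q + (1 - 1)) * (q + (0 - 1))) •
              coadj (cpxPsi z D.θ 1 (0 - 1) (1 - 1)))))
        ∘ₗ dualMap (D.homotopy.Δ.hom (1 - 1) 1).hom)
    + (((cpx z).d 1 0).hom ∘ₗ D.homotopy.η 0 1 1
    + Int.negOnePow (q + 0) • (D.homotopy.η 0 2 0 ∘ₗ dualMap ((cpx z).d (1 + 1) 1).hom)
    + Int.negOnePow (2 * q + 2 - (0 : ℕ) - 1) •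
        (D.homotopy.η 1 1 0 + Int.negOnePow 1 •
          (Int.negOnePow ((q + 1) * (q + 0)) • coadj (D.homotopy.η 1 0 1)))) at h
  rw [show flipChi t D.θ D.ν D.κ 0 1 0 = 0 from rfl, sub_zero, hψ₁, hψ₂, hd, hs₁, hs₂, hs₃] at h
  have hz : dualMap (0 : (cpx z).X (1 + 1) ⟶ (cpx z).X 1).hom = 0 :=
    LinearMap.ext fun φ => SDual.ext fun x => map_zero φ
  rw [coadj_zero, smul_zero, LinearMap.comp_zero, smul_zero, add_zero, LinearMap.zero_comp,
    LinearMap.comp_zero, neg_zero, zero_add, hz, LinearMap.comp_zero, smul_zero, add_zero,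
    one_smul] at h
  have h' : (0 : F × SDual Λ F) = -ε • t.hypEquiv (blk 0 0 LinearMap.id 0 (dualHyp Λ F (dualMap D.Δ₁ a))) +
      (-(ε • z.incl (D.η₀ a)) +
        (-1 : ℤˣ) • (D.η₁ a + Int.negOnePow 1 • coadj D.η₁' a)) :=
    (LinearMap.congr_fun h a).trans (congrArg
      (fun b : F × SDual Λ F => -ε • t.hypEquiv (blk 0 0 LinearMap.id 0 (dualHyp Λ F (dualMap D.Δ₁ a))) +
        (b + (-1 : ℤˣ) • (D.η₁ a + Int.negOnePow 1 • coadj D.η₁' a)))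
      (cpx_d₁ (z := z) (D.η₀ a)))
  rw [Int.negOnePow_one] at h'
  rw [h', blk_id]
  simp only [Units.neg_smul, one_smul]
  abel

/-- The component `C^q → C_{q+1}` at `s = 0`, evaluated at the functional `Φ v`. The element `n`
stands for the dual of `Δ_q` applied to this functional. -/
theorem homotopy_eq₀ (hε : Int.negOnePow q = ε) (v : F × SDual Λ F) (n : G)
    (hn : ∀ a : SDual Λ G, a n = star (Φ v (D.Δ₀ a))) :
    -D.Δ₁ (κ v.2) + ε • t.β n + D.Δ₁ (ι (z.γ n)) + ε • D.η₀ (z.proj v)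
      - (D.η₁' (Φ v) - coadj D.η₁ (Φ v)) = 0 := by
  have h := congrFun (congrFun (congrFun D.homotopy.eq 0) 0) 1
  have hd : (cpx z).d (1 + 1) 1 = 0 := ChainComplex.of_d (cpxX Λ F G) (cpxD z) 1
  have hs₁ : Int.negOnePow (q + 1 + 1) = ε := by
    rw [Int.negOnePow_succ, Int.negOnePow_succ, hε, neg_neg]
  have hs₄ : Int.negOnePow (q + 1) = -ε := by rw [Int.negOnePow_succ, hε]
  have hs₂ : Int.negOnePow ((q + 0) * (q + 1)) = 1 := by
    rw [add_zero]
    exact Int.negOnePow_even _ (Int.even_mul_succ_self q)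
  have hs₅ : Int.negOnePow ((q + (0 - 1)) * (q + (1 - 1))) = 1 := by
    refine Int.negOnePow_even _ ?_
    have := Int.even_mul_succ_self (q - 1)
    rwa [sub_add_cancel, show q - 1 = q + (0 - 1) by ring,
      show (q + (0 - 1)) * q = (q + (0 - 1)) * (q + (1 - 1)) by ring] at this
  have hs₆ : Int.negOnePow (2 * q) = 1 := Int.negOnePow_two_mul q
  have hs₃ : Int.negOnePow (2 * q + 2 - (0 : ℕ) - 1) = -1 := by
    refine Int.negOnePow_odd _ ⟨q, ?_⟩
    push_cast
    ring
  change flipChi t D.θ D.ν D.κ 0 0 1 - 0 =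
    -((D.homotopy.Δ.hom (1 - 1) 1).hom ∘ₗ cpxPsi z D.θ 0 0 (1 - 1) ∘ₗ dualMap _)
    + Int.negOnePow (q + 1 + 1) •
        ((((flipMap t).f 1).hom ∘ₗ cpxPsi z D.θ 0 (0 - 1) 1
          + Int.negOnePow (2 * q) • ((D.homotopy.Δ.hom (1 - 1) 1).hom ∘ₗ
            (Int.negOnePow ((q + (0 - 1)) * (q + (1 - 1))) •
              coadj (cpxPsi z D.θ 1 (1 - 1) (0 - 1)))))
        ∘ₗ dualMap (D.homotopy.Δ.hom (0 - 1) 0).hom)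
    + (((cpx z).d (1 + 1) 1).hom ∘ₗ D.homotopy.η 0 0 (1 + 1)
    + Int.negOnePow (q + 1) • (D.homotopy.η 0 1 1 ∘ₗ dualMap ((cpx z).d 1 0).hom)
    + Int.negOnePow (2 * q + 2 - (0 : ℕ) - 1) •
        (D.homotopy.η 1 0 1 + Int.negOnePow 1 •
          (Int.negOnePow ((q + 0) * (q + 1)) • coadj (D.homotopy.η 1 1 0)))) at h
  rw [show flipChi t D.θ D.ν D.κ 0 0 1 = 0 from rfl, sub_zero, hd, hs₁, hs₂, hs₃, hs₄, hs₅, hs₆, one_smul, one_smul, one_smul] at h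
  have hz : (0 : (cpx z).X (1 + 1) ⟶ (cpx z).X 1).hom = 0 := rfl
  rw [hz, LinearMap.zero_comp, zero_add] at h
  let ψ₁ : SDual Λ (F × SDual Λ F) →ₗ[Λ] SDual Λ G :=
    LinearMap.coprod (ε • dualMap z.γ) 0 ∘ₗ (dualHyp Λ F).toLinearMap
  have h' : (0 : G) = -D.Δ₁ (blk 0 0 LinearMap.id 0 (dualHyp Λ F (Φ v))) +
      ε • (t.β ((evEquiv Λ G).symm (dualMap D.Δ₀ (Φ v))) +
        D.Δ₁ (coadj ψ₁ (dualMap D.Δ₀ (Φ v)))) +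
      (-ε • D.η₀ (dualMap (show G →ₗ[Λ] F × SDual Λ F from ((cpx z).d 1 0).hom) (Φ v)) +
        (-1 : ℤˣ) • (D.η₁' (Φ v) + Int.negOnePow 1 • coadj D.η₁ (Φ v))) :=
    LinearMap.congr_fun h (Φ v)
  have e₁ : (evEquiv Λ G).symm (dualMap D.Δ₀ (Φ v)) = n := by
    apply eq_of_forall_dual (Λ := Λ)
    intro a
    rw [apply_evEquiv_symm, hn]
    rfl
  have e₂ : coadj ψ₁ (dualMap D.Δ₀ (Φ v)) = ε • ι (z.γ n) := by
    apply eq_of_forall_dual (Λ := Λ)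
    intro φ
    rw [apply_coadj]
    change star (Φ v (D.Δ₀ (ψ₁ φ))) = φ (ε • ι (z.γ n))
    rw [← hn]
    change (ε • dualMap z.γ (dualHyp Λ F φ).1 + 0) n = φ (ε • ι (z.γ n))
    rw [add_zero]
    rcases Int.units_eq_one_or ε with rfl | rfl <;>
      simp only [one_smul, Units.neg_smul, map_neg] <;> rfl
  have e₃ : dualMap (show G →ₗ[Λ] F × SDual Λ F from ((cpx z).d 1 0).hom) (Φ v) =
      -z.proj v := by
    ext b
    refine (congrArg (Φ v) (cpx_d₁ (z := z) b)).trans ?_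
    have := z.hyp_incl v b
    rcases Int.units_eq_one_or ε with rfl | rfl <;> simp at this ⊢ <;> exact this
  rw [e₁, e₂, e₃, blk_id, dualHyp_hyp_fst, Int.negOnePow_one] at h'
  rw [h']
  rcases Int.units_eq_one_or ε with rfl | rfl <;>
    simp only [one_smul, Units.neg_smul, map_neg, neg_neg] <;> abel

end SignatureData

end Homotopy

/-! ### The twisted double of a quadratic signature -/

namespace SignatureData

variable {Λ : Type u} [Ring Λ] [StarRing Λ]
variable {F G : Type u} [AddCommGroup F] [Module Λ F] [Module.Free Λ F] [Module.Finite Λ F]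
  [AddCommGroup G] [Module Λ G] [Module.Free Λ G] [Module.Finite Λ G]
variable {ε : ℤˣ} {z : Preformation Λ ε F G} {t : FlipIso z} {q : ℤ} (D : SignatureData q t)

local notation "ι" => LinearMap.inl Λ F (SDual Λ F)
local notation "κ" => LinearMap.inr Λ F (SDual Λ F)
local notation "Φ" => hyp ε F

/-- The dual of `Δ_{q+1}`, up to the hyperbolic form. -/
noncomputable def r : SDual Λ G →ₗ[Λ] F × SDual Λ F := hypInv ε F ∘ₗ dualMap D.Δ₁

/-- The dual of `Δ_q`, up to the hyperbolic form. -/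
noncomputable def n : F × SDual Λ F →ₗ[Λ] G :=
  (evEquiv Λ G).symm.toLinearMap ∘ₗ dualMap D.Δ₀ ∘ₗ Φ

/-- The map `η₀ - ε η₀* + ε R S*`. -/
noncomputable def H : SDual Λ G →ₗ[Λ] G :=
  D.η₀ - ε • coadj D.η₀ + ε • (D.Δ₁ ∘ₗ ι ∘ₗ LinearMap.fst Λ F (SDual Λ F) ∘ₗ D.r)

theorem hyp_r (a : SDual Λ G) (v : F × SDual Λ F) : Φ (D.r a) v = a (D.Δ₁ v) := by
  change hyp ε F (hypInv ε F (dualMap D.Δ₁ a)) v = _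
  rw [hyp_hypInv]
  rfl

theorem apply_n (a : SDual Λ G) (v : F × SDual Λ F) : a (D.n v) = star (Φ v (D.Δ₀ a)) :=
  apply_evEquiv_symm a (dualMap D.Δ₀ (Φ v))

theorem H_apply (a : SDual Λ G) :
    D.H a = D.η₀ a - ε • coadj D.η₀ a + ε • D.Δ₁ (ι (D.r a).1) := rfl

/-- The `Φ`-adjoint of `hypEquiv_eq`: the adjoint of `h` is `h⁻¹`, while `Δ₀ ∘ proj` and `ε incl ∘
Δ₁` have adjoints `incl ∘ n` and `r ∘ proj`. -/
theorem r_proj_sub_incl_n (v : F × SDual Λ F) :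
    D.r (z.proj v) - z.incl (D.n v) = v - t.hypEquiv.symm v := by
  apply hyp_injective ε
  intro x
  have h₁ : Φ (t.hypEquiv x) v = Φ x (t.hypEquiv.symm v) := by
    rw [← t.hyp_hypEquiv x, LinearEquiv.apply_symm_apply]
  have h₂ : Φ (D.Δ₀ (z.proj x)) v = Φ x (z.incl (D.n v)) := by
    rw [z.hyp_incl, apply_n, ← hyp_symm]
  have h₃ : ε • Φ (z.incl (D.Δ₁ x)) v = Φ x (D.r (z.proj v)) := by
    rw [hyp_symm ε x, hyp_r, z.hyp_incl_left]
  rw [D.hypEquiv_eq, map_add, map_sub, SDual.add_apply, SDual.sub_apply, h₂] at h₁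
  have h₄ : (ε • z.incl (D.Δ₁ x)) = z.incl (ε • D.Δ₁ x) := by
    rcases Int.units_eq_one_or ε with rfl | rfl <;> simp only [one_smul, Units.neg_smul, map_neg]
  have h₅ : Φ (ε • z.incl (D.Δ₁ x)) v = Φ x (D.r (z.proj v)) := by
    rw [← h₃]
    rcases Int.units_eq_one_or ε with rfl | rfl <;>
      simp only [one_smul, Units.neg_smul, map_neg, SDual.neg_apply]
  rw [h₅] at h₁
  rw [map_sub, map_sub, ← h₁]
  abel

/-- The one place where the equation for `η` enters; it is what makes `(proj, -n)` a variation map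
for `formA`. -/
theorem H_proj_add (hε : Int.negOnePow q = ε) (v : F × SDual Λ F) :
    D.H (z.proj v) + t.β (D.n v) = ε • D.Δ₁ v := by
  -- The dual of `homotopy_eq₁` is added to `homotopy_eq₀`: both components of `η_1` occur with
  -- opposite signs and disappear.
  have key : -D.Δ₁ (κ v.2) + ε • t.β (D.n v) + D.Δ₁ (ι (z.γ (D.n v))) + ε • D.η₀ (z.proj v)
      - coadj D.η₀ (z.proj v) - D.Δ₁ (ι (t.hypEquiv.symm v).1) = 0 := by
    apply eq_of_forall_dual (Λ := Λ)
    intro a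
    have e₁ := congrArg (fun x => star (Φ v x)) (D.homotopy_eq₁ hε a)
    have e₀ := congrArg a (D.homotopy_eq₀ hε v (D.n v) fun a => D.apply_n a v)
    have h₁ : Φ (t.hypEquiv (κ (dualHyp Λ F (dualMap D.Δ₁ a)).1)) v =
        a (D.Δ₁ (ι (t.hypEquiv.symm v).1)) := by
      rw [← t.hypEquiv.apply_symm_apply v, t.hyp_hypEquiv, hyp_inr_left, dualHyp_fst,
        LinearEquiv.symm_apply_apply]
      rfl
    rw [hyp_symm] at h₁
    have h₂ := apply_coadj D.η₁ a (Φ v)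
    have h₃ := apply_coadj D.η₁' (Φ v) a
    have h₄ := z.hyp_incl v (D.η₀ a)
    have h₅ := apply_coadj D.η₀ a (z.proj v)
    rw [map_zero] at e₀ ⊢
    rw [map_zero, star_zero] at e₁
    rcases Int.units_eq_one_or ε with rfl | rfl <;>
    · simp only [one_smul, Units.neg_smul, map_neg, map_sub, map_add, star_neg, star_sub,
        star_add, neg_neg, h₃, h₄, star_star] at h₁ e₀ e₁ ⊢
      rw [h₅, ← h₁]
      rw [h₂] at e₀
      rw [← add_zero (0 : Λ)]
      nth_rewrite 1 [← e₀]
      rw [← e₁]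
      abel
  -- The `F`-component of `r_proj_sub_incl_n` expresses the unknown `(h⁻¹ v).1` through `(r (proj
  -- v)).1`, which produces the last term of `H`.
  have hr := congrArg Prod.fst (D.r_proj_sub_incl_n v)
  change (D.r (z.proj v)).1 - z.γ (D.n v) = v.1 - (t.hypEquiv.symm v).1 at hr
  rw [sub_eq_iff_eq_add] at hr
  have hv : D.Δ₁ v = D.Δ₁ (ι v.1) + D.Δ₁ (κ v.2) := by
    rw [← map_add]
    simp
  rw [H_apply, hr, hv]
  rcases Int.units_eq_one_or ε with rfl | rfl
  · simp only [one_smul, map_sub, map_add] at key ⊢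
    rw [← sub_eq_zero, ← key]
    abel
  · simp only [one_smul, Units.neg_smul, map_sub, map_add] at key ⊢
    rw [← sub_eq_zero, ← neg_eq_zero, ← key]
    abel

/-- The form on `G* ⊕ G`. -/
noncomputable def formA : (SDual Λ G × G) ≃ₗ[Λ] SDual Λ (SDual Λ G × G) :=
  LinearEquiv.ofLinearMap
    ((D.H ∘ₗ LinearMap.fst Λ (SDual Λ G) G - t.β.toLinearMap ∘ₗ LinearMap.snd Λ (SDual Λ G) G).prod
      (ε • LinearMap.fst Λ (SDual Λ G) G))
    ((ε • LinearMap.snd Λ G (SDual Λ G)).prod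
      (t.β.symm.toLinearMap ∘ₗ (ε • D.H ∘ₗ LinearMap.snd Λ G (SDual Λ G)
        - LinearMap.fst Λ G (SDual Λ G))))
    (by ext <;> simp [smul_smul])
    (by ext <;> simp [smul_smul]) ≪≫ₗ
  ((evEquiv Λ G).prodCongr (LinearEquiv.refl Λ (SDual Λ G)) ≪≫ₗ dualProd Λ (SDual Λ G) G)

theorem formA_apply (e e' : SDual Λ G × G) : D.formA e e' =
    star (e'.1 (D.H e.1 - t.β e.2)) + ε • e.1 e'.2 := by
  rcases Int.units_eq_one_or ε with rfl | rfl <;> rfl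

/-- The map `G* ⊕ G → F ⊕ F*`. -/
noncomputable def w : SDual Λ G × G →ₗ[Λ] F × SDual Λ F := D.r.coprod z.incl

/-- The part `η₀ - ε η₀*` of `H` cancels on symmetrizing, and its last term symmetrizes to `Φ(r a, r
a')` because `F` and `F*` are isotropic. The mixed terms are `Δ₁_incl`, and `incl` has isotropic
image. -/
theorem formA_add (e e' : SDual Λ G × G) :
    Φ (D.w e) (D.w e') = D.formA e e' + ε • star (D.formA e' e) := by
  obtain ⟨a, b⟩ := e
  obtain ⟨a', b'⟩ := e'
  have h₁ : a (D.Δ₁ (D.r a')) = Φ (ι (D.r a).1) (D.r a') + a (D.Δ₁ (ι (D.r a').1)) := by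
    rw [← D.hyp_r, hyp_eq_add, ← D.hyp_r]
  rw [hyp_symm, D.hyp_r] at h₁
  have h₂ := apply_coadj D.η₀ a' a
  have h₃ := apply_coadj D.η₀ a a'
  have h₄ : Φ (z.incl b) (D.r a') = ε • star (a' (D.Δ₁ (z.incl b))) := by
    rw [hyp_symm, D.hyp_r]
  rw [formA_apply, formA_apply]
  change Φ (D.r a + z.incl b) (D.r a' + z.incl b') = star (a' (D.H a - t.β b)) + ε • a b' +
    ε • star (star (a (D.H a' - t.β b')) + ε • a' b)
  rw [map_add, map_add, SDual.add_apply, SDual.add_apply, z.hyp_incl_incl, h₄, D.hyp_r,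
    D.hyp_r, h₁, D.Δ₁_incl, D.Δ₁_incl, H_apply, H_apply]
  rcases Int.units_eq_one_or ε with rfl | rfl <;>
  · simp only [one_smul, Units.neg_smul, map_neg, map_sub, map_add, star_neg, star_sub,
      star_add, neg_neg, star_star, h₂, h₃]
    abel

/-- The lagrangian `G` of the form on `G* ⊕ G`. -/
def lagA (Λ G : Type u) [Ring Λ] [StarRing Λ] [AddCommGroup G] [Module Λ G] :
    Submodule Λ (SDual Λ G × G) := Submodule.prod ⊥ ⊤

theorem mem_lagA (e : SDual Λ G × G) : e ∈ lagA Λ G ↔ e.1 = 0 :=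
  ⟨fun h => h.1, fun h => ⟨h, trivial⟩⟩

theorem mem_lagA_iff_left (e : SDual Λ G × G) :
    e ∈ lagA Λ G ↔ ∀ d ∈ lagA Λ G, D.formA e d = 0 := by
  rw [mem_lagA]
  constructor
  · intro h d hd
    rw [mem_lagA] at hd
    rw [formA_apply, h, hd]
    simp
  · intro h
    ext b
    have := h (0, b) ((mem_lagA _).2 rfl)
    rw [formA_apply] at this
    rcases Int.units_eq_one_or ε with rfl | rfl <;> simpa using this

theorem mem_lagA_iff_right (e : SDual Λ G × G) :
    e ∈ lagA Λ G ↔ ∀ d ∈ lagA Λ G, D.formA d e = 0 := by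
  constructor
  · intro h d hd
    exact (D.mem_lagA_iff_left d).1 hd e h
  · intro h
    rw [mem_lagA]
    ext b
    have := h (0, t.β.symm b) ((mem_lagA _).2 rfl)
    rw [formA_apply] at this
    simpa using this

/-- `T` turns the right annihilator condition into the left one, and `0 ⊕ G` is its own annihilator
on either side. -/
theorem monodromy_mem_lagA (e : SDual Λ G × G) :
    monodromy ε D.formA e ∈ lagA Λ G ↔ e ∈ lagA Λ G := by
  rw [D.mem_lagA_iff_right, D.mem_lagA_iff_left]
  refine forall₂_congr fun d _ => ?_
  rw [apply_monodromy]
  rcases Int.units_eq_one_or ε with rfl | rfl <;> simp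

/-- The twisted double of the data of a quadratic signature. -/
noncomputable def twistedDouble (hε : Int.negOnePow q = ε) :
    TwistedDouble Λ ε (SDual Λ G × G) F where
  h := t.hypEquiv
  hyp_h := t.hyp_hypEquiv
  g := t.α ≪≫ₗ signEquiv ε _
  h_inl x := by
    rw [t.hypEquiv_apply]
    refine Prod.ext (map_zero (invStar t.α)) ?_
    change ε • t.α x + ε • t.α (symmDual ε t.ν 0) = ε • t.α x
    rw [map_zero, map_zero, smul_zero, add_zero]
  g' := adjEquiv t.α
  h_symm_inl x := by
    rw [t.hypEquiv_symm_apply]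
    rfl
  A := D.formA
  T := monodromy ε D.formA
  w := D.w
  ζ := z.proj.prod (-D.n)
  A_sub e e' := by rw [apply_monodromy, sub_neg_eq_add, D.formA_add]
  A_T_right := apply_monodromy ε D.formA
  w_ζ v := by
    rw [← D.r_proj_sub_incl_n, sub_eq_add_neg, ← map_neg]
    rfl
  -- On the `G*`-component this is `H_proj_add`, on the `G`-component it is the duality of `proj`
  -- and `incl`.
  A_ζ v e := by
    obtain ⟨a, b⟩ := e
    rw [formA_apply]
    change star (a (D.H (z.proj v) - t.β (-D.n v))) + ε • z.proj v b = Φ v (D.r a + z.incl b)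
    rw [map_neg, sub_neg_eq_add, D.H_proj_add hε, map_add, z.hyp_incl, hyp_symm, D.hyp_r]
    rcases Int.units_eq_one_or ε with rfl | rfl <;>
      simp only [one_smul, Units.neg_smul, map_neg, star_neg]
  K := lagA Λ G
  isDirectSummand_K :=
    IsDirectSummand.prod ⟨⊤, isCompl_bot_top⟩ ⟨⊥, isCompl_top_bot⟩
  mem_K := D.mem_lagA_iff_left
  T_mem_K := D.monodromy_mem_lagA

/-- The isomorphism `G* ⊕ G ⊕ F ≅ (G* ⊕ G) ⊕ F`. -/
def shear (z : Preformation Λ ε F G) : (SDual Λ G × G × F) ≃ₗ[Λ] (SDual Λ G × G) × F :=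
  LinearEquiv.ofLinearMap
    (((LinearMap.fst Λ _ _).prod (LinearMap.fst Λ _ _ ∘ₗ LinearMap.snd Λ _ _)).prod
      ((LinearMap.snd Λ _ _ + z.γ ∘ₗ LinearMap.fst Λ _ _) ∘ₗ LinearMap.snd Λ _ _))
    ((LinearMap.fst Λ _ _ ∘ₗ LinearMap.fst Λ _ _).prod
      ((LinearMap.snd Λ _ _ ∘ₗ LinearMap.fst Λ _ _).prod
        (LinearMap.snd Λ _ _ - z.γ ∘ₗ LinearMap.snd Λ _ _ ∘ₗ LinearMap.fst Λ _ _)))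
    (by ext <;> simp) (by ext <;> simp)

/-- The substitution `c ↦ c + γ b` cancels the contribution of `incl b` to `(w e).1 - x`. The entry
on `G` becomes `γ* μ = θ - ε θ*`, and the entry between `G*` and `G` is matched by `Δ₁_incl`. -/
theorem quadForm_iso (hε : Int.negOnePow q = ε) :
    D.quadForm.toAsym.Iso (D.twistedDouble hε).fstForm := by
  refine ⟨shear z, ?_⟩
  ext ⟨(a : SDual Λ G), (b : G), (c : F)⟩ ⟨(a' : SDual Λ G), (b' : G), (c' : F)⟩
  have hθ : ∀ b b', D.θ b b' - ε • star (D.θ b' b) = z.μ b (z.γ b') := by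
    intro b b'
    have h := z.symm_θ
    rw [← D.mk_θ, QMod.symm_mk] at h
    have h' := congrArg (fun φ : G →ₗ[Λ] SDual Λ G => φ b b') h
    change _ = z.μ b (z.γ b') at h'
    rw [← h']
    rcases Int.units_eq_one_or ε with rfl | rfl <;> simp [Tmod, sub_eq_add_neg]
  let ξ : SDual Λ G × G × F → SDual Λ G × G × F → Λ := fun x x' =>
    (-star (x'.1 (D.η₀ x.1)) + (star (x'.1 (t.β x.2.1)) + 0)) +
      ((0 + (-(ε • star (D.θ x'.2.1 x.2.1)) + 0)) +
        (x.1 (D.Δ₁ (ι x'.2.2)) + (z.μ x.2.1 x'.2.2 + 0)))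
  have hl : D.quadForm.toAsym.form (a, b, c) (a', b', c') =
      ξ (a, b, c) (a', b', c') + -ε • star (ξ (a', b', c') (a, b, c)) := by
    rcases Int.units_eq_one_or ε with rfl | rfl <;> rfl
  rw [hl]
  change -D.formA (a, b) (a', b') +
    Φ (ι ((D.r a + z.incl b).1 - (c + z.γ b))) (D.r a' + z.incl b') +
    Φ (D.r a + z.incl b) (ι (c' + z.γ b')) = _
  have h₁ : (D.r a + z.incl b).1 - (c + z.γ b) = (D.r a).1 - c := by
    change (D.r a).1 + z.γ b - (c + z.γ b) = _
    abel
  have h₂ := apply_coadj D.η₀ a' a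
  have h₃ : ∀ y, Φ (ι y) (D.r a') = ε • star (a' (D.Δ₁ (ι y))) := by
    intro y
    rw [hyp_symm, D.hyp_r]
  have h₄ : ∀ y, Φ (ι y) (z.incl b') = ε • star (z.μ b' y) := fun y => hyp_inl_left ε y (z.incl b')
  have h₅ : ∀ y, Φ (z.incl b) (ι y) = z.μ b y := hyp_inl ε (z.incl b)
  -- Two evaluations of `Φ(r a, incl b')`: by splitting into `F`-components, and as `a(Δ₁ (incl
  -- b'))`.
  have h₆ : a (D.Δ₁ (ι (z.γ b'))) + ε • star (z.μ b' (D.r a).1) = ε • a (b' - t.β b') := by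
    have h := D.hyp_r a (z.incl b')
    rw [hyp_eq_add, D.Δ₁_incl, hyp_inl_left, add_comm] at h
    refine Eq.trans ?_ (h.trans ?_)
    · rw [D.hyp_r]
      rfl
    · rcases Int.units_eq_one_or ε with rfl | rfl <;> simp
  rw [formA_apply, h₁, H_apply]
  rw [map_add (Φ (ι _)), map_add Φ, SDual.add_apply, map_sub ι]
  simp only [map_add, map_sub, SDual.sub_apply, h₃, h₄, h₅, D.hyp_r, ← hθ b b', ξ]
  have h₇ := eq_sub_of_add_eq h₆
  rw [h₇]
  rcases Int.units_eq_one_or ε with rfl | rfl <;>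
  · simp only [one_smul, Units.neg_smul, map_neg, map_sub, map_add, star_neg, star_sub,
      star_add, neg_neg, star_star, h₂, star_zero]
    abel

end SignatureData

/-! ### The form representing the asymmetric signature -/

section

variable {Λ : Type u} [Ring Λ] [StarRing Λ]
variable {F G : Type u} [AddCommGroup F] [Module Λ F] [Module.Free Λ F] [Module.Finite Λ F]
  [AddCommGroup G] [Module Λ G] [Module.Free Λ G] [Module.Finite Λ G]
variable {ε : ℤˣ} {z : Preformation Λ ε F G} (t : FlipIso z) {q : ℤ}

local notation "κ" => LinearMap.inr Λ F (SDual Λ F)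
local notation "Φ" => hyp ε F

/-- The map `ε α (ν* - ε ν) α*`. -/
noncomputable def FlipIso.twist : F →ₗ[Λ] SDual Λ F :=
  ε • (t.α.toLinearMap ∘ₗ symmDual ε t.ν ∘ₗ adj t.α.toLinearMap)

/-- The `(-ε)`-symmetry of `ν* - ε ν`, transported along `α*`. -/
theorem FlipIso.twist_apply (x y : F) : t.twist x y = -(ε • star (t.twist y x)) := by
  have h := apply_symmDual t.ν (adj t.α.toLinearMap x) (adj t.α.toLinearMap y)
  rw [adj_apply, star_star, adj_apply] at h
  change (ε • t.α (symmDual ε t.ν (adj t.α.toLinearMap x))) y =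
    -(ε • star ((ε • t.α (symmDual ε t.ν (adj t.α.toLinearMap y))) x))
  change t.α _ _ = -(ε • star (t.α _ _)) at h
  rcases Int.units_eq_one_or ε with rfl | rfl <;>
    simp only [one_smul, Units.neg_smul, SDual.neg_apply, star_neg, neg_neg] at h ⊢ <;> rw [h]

/-- The rows can be solved in turn: the first gives `c`, the second then `x`, and the third `y`. -/
theorem FlipIso.asymForm_nonsingular : t.asymForm.Nonsingular := by
  let f : (F × SDual Λ F × F) ≃ₗ[Λ] SDual Λ F × SDual Λ (SDual Λ F) × SDual Λ F :=
    LinearEquiv.ofLinearMap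
      ((row 0 0 t.α.toLinearMap).prod ((row (ev Λ F) 0 (-(ε • ev Λ F))).prod
        (row 0 LinearMap.id t.twist)))
      (((evEquiv Λ F).symm.toLinearMap ∘ₗ LinearMap.fst Λ _ _ ∘ₗ LinearMap.snd Λ _ _
          + ε • (t.α.symm.toLinearMap ∘ₗ LinearMap.fst Λ _ _)).prod
        ((LinearMap.snd Λ _ _ ∘ₗ LinearMap.snd Λ _ _
          - t.twist ∘ₗ t.α.symm.toLinearMap ∘ₗ LinearMap.fst Λ _ _).prod
          (t.α.symm.toLinearMap ∘ₗ LinearMap.fst Λ _ _)))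
      (by
        have h : ∀ x, ev Λ F ((evEquiv Λ F).symm x) = x := (evEquiv Λ F).apply_symm_apply
        ext <;> simp [row, h, smul_smul])
      (by
        have h : ∀ x, (evEquiv Λ F).symm (ev Λ F x) = x := (evEquiv Λ F).symm_apply_apply
        ext <;> simp [row, h, smul_smul])
  exact (f ≪≫ₗ (LinearEquiv.refl Λ (SDual Λ F)).prodCongr (dualProd Λ (SDual Λ F) F) ≪≫ₗ
    dualProd Λ F (SDual Λ F × F)).bijective

/-- The isomorphism `F ⊕ F* ⊕ F ≅ (F ⊕ F*) ⊕ F*`. -/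
noncomputable def FlipIso.shear : (F × SDual Λ F × F) ≃ₗ[Λ] (F × SDual Λ F) × SDual Λ F :=
  let x := LinearMap.fst Λ F (SDual Λ F × F)
  let y := LinearMap.fst Λ (SDual Λ F) F ∘ₗ LinearMap.snd Λ F (SDual Λ F × F)
  let c := LinearMap.snd Λ (SDual Λ F) F ∘ₗ LinearMap.snd Λ F (SDual Λ F × F)
  let c' := LinearMap.fst Λ F (SDual Λ F) ∘ₗ LinearMap.fst Λ (F × SDual Λ F) (SDual Λ F)
  let p' := LinearMap.snd Λ F (SDual Λ F) ∘ₗ LinearMap.fst Λ (F × SDual Λ F) (SDual Λ F)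
  let q' := LinearMap.snd Λ (F × SDual Λ F) (SDual Λ F)
  LinearEquiv.ofLinearMap
    ((c.prod (y + t.twist ∘ₗ c)).prod
      ((adjEquiv t.α).toLinearMap ∘ₗ (ε • x - c) - (y + t.twist ∘ₗ c)))
    ((ε • ((adjEquiv t.α).symm.toLinearMap ∘ₗ (q' + p') + c')).prod
      ((p' - t.twist ∘ₗ c').prod c'))
    (by
      apply LinearMap.ext
      rintro ⟨⟨v, v'⟩, v''⟩
      simp [smul_smul, x, y, c, c', p', q'])
    (by
      apply LinearMap.ext
      rintro ⟨v, v', v''⟩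
      simp [x, y, c, c', p', q']
      rw [smul_sub, smul_smul, Int.units_mul_self, one_smul, sub_add_cancel])

/-- With `k = ε x - c`, the coordinates are chosen so that `v + κ q = (c, α* k)`. Its image under
`h` is `(k, ε α c + twist k)`, so `α^{-*}` disappears from the form. -/
theorem SignatureData.asymForm_iso (D : SignatureData q t) (hε : Int.negOnePow q = ε) :
    t.asymForm.Iso (D.twistedDouble hε).sndForm := by
  refine ⟨t.shear, ?_⟩
  ext ⟨(x : F), (y : SDual Λ F), (c : F)⟩ ⟨(x' : F), (y' : SDual Λ F), (c' : F)⟩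
  let k : F := ε • x - c
  let s : SDual Λ F := adj t.α.toLinearMap (ε • x' - c')
  have hl : t.asymForm.form (x, y, c) (x', y', c') = t.α c x' +
      (star (y' x) - ε • star (y' c) + (y c' + t.twist c c')) := by
    change (0 + (0 + t.α c x')) + ((star (y' x) + (0 + (-(ε • ev Λ F) c) y')) +
      (0 + (y c' + t.twist c c'))) = _
    rcases Int.units_eq_one_or ε with rfl | rfl <;> simp [sub_eq_add_neg]
  -- The `F*`-part of `v` cancels against `q`, leaving only `α* k`.
  have hu : ((c, y + t.twist c) : F × SDual Λ F) +
      κ (adj t.α.toLinearMap k - (y + t.twist c)) = (c, adj t.α.toLinearMap k) := by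
    ext <;> simp
  have hu' : ((c', y' + t.twist c') : F × SDual Λ F) + κ (s - (y' + t.twist c')) = (c', s) := by
    ext <;> simp
  rw [hl]
  change Φ (c, y + t.twist c) ((c', y' + t.twist c') + κ (s - (y' + t.twist c'))) +
    Φ (t.hypEquiv ((c, y + t.twist c) + κ (adj t.α.toLinearMap k - (y + t.twist c))))
      (c', y' + t.twist c') = _
  have hk : ε • t.α (symmDual ε t.ν (adj t.α.toLinearMap k)) = t.twist k := rfl
  have hs : s c = star (t.α c (ε • x' - c')) := rfl
  have h := t.twist_apply k c'
  rw [hu, hu', t.hypEquiv_apply, hyp_apply, hyp_apply, invStar_adj, hk]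
  simp only [hs, star_star, SDual.add_apply, h, star_add]
  have hk' : star (y' k) = ε • star (y' x) - star (y' c) := by
    rcases Int.units_eq_one_or ε with rfl | rfl <;> simp [k]
  rw [hk']
  rcases Int.units_eq_one_or ε with rfl | rfl
  · simp only [one_smul, map_sub]
    abel
  · simp only [one_smul, Units.neg_smul, map_sub, map_neg, SDual.neg_apply]
    abel

end

end AlgSurgery

/-! ### Comparison of the two signatures -/

theorem mainTheorem11 {Λ : Type u} [Ring Λ] [StarRing Λ]
    (hΛ : AlgSurgery.WeaklyFinite Λ) (q : ℕ) (hq : 2 ≤ q)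
    {F G : Type u} [AddCommGroup F] [Module Λ F] [Module.Free Λ F] [Module.Finite Λ F]
    [AddCommGroup G] [Module Λ G] [Module.Free Λ G] [Module.Finite Λ G]
    (z : AlgSurgery.Preformation Λ (Int.negOnePow q) F G) (t : AlgSurgery.FlipIso z)
    (D : AlgSurgery.SignatureData (q : ℤ) t) :
    ∃ (hξ : D.quadForm.Nonsingular) (hρ : t.asymForm.Nonsingular),
      AlgSurgery.LQuad.toLAsy0 (AlgSurgery.LQuad.mk D.quadForm hξ) =
        AlgSurgery.LAsy0.mk t.asymForm hρ := by
  have h₁ := D.quadForm_iso rfl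
  have h₂ := D.asymForm_iso t rfl
  have hξ : D.quadForm.toAsym.Nonsingular := .of_iso h₁ (D.twistedDouble rfl).fstForm_nonsingular
  refine ⟨hξ, t.asymForm_nonsingular, ?_⟩
  refine Quotient.sound (s := AlgSurgery.AsymForm.wittSetoid Λ) ?_
  -- The chain is `ξ - ε ξ* ≅ fstForm ∼ sndForm ≅ ρ`, where `sndForm` inherits non-singularity from
  -- `ρ`.
  exact h₁.wittEquiv.trans (((D.twistedDouble rfl).fstForm_wittEquiv
    (.of_iso h₂.symm t.asymForm_nonsingular)).trans h₂.symm.wittEquiv)
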